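/- Fix a relational schema $\mathbf{R}=(R_1,\dots,R_k)$ of relation names with fixed arities, and a nonempty domain of values, each written as a string over a fixed finite alphabet so that distinct values have distinct strings. A database $D$ is a finite set of tuples $R_i(\vec c)$. For each $R_i$ there is a delta relation $\Delta_i$ of the same arity, holding the deleted tuples of $R_i$. A delta rule has the form $$\Delta_i(\vec X) \;{:}{-}\; R_i(\vec X), Q_1(\vec Y_1),\dots,Q_l(\vec Y_l),\qquad l\ge 0,\quad Q_j\in\{R_1,\dots,R_k,\Delta_1,\dots,\Delta_k\},$$ where $\vec X,\vec Y_1,\dots,\vec Y_l$ are vectors of variables and constants. A delta program $P$ is a finite set of delta rules. For a state $E$, consisting of contents for all $R_i$ and $\Delta_i$, let $P[E]$ be the set of all delta tuples $\alpha(\mathrm{head}(r))$ where $r\in P$ and $\alpha$ is an assignment of values to the variables that maps every body atom of $r$ to a tuple of $E$ (constants are mapped to themselves). Write $R^t$ and $\Delta^t$ for the contents of the relations and of the delta relations of the state $D^t$, where a deleted tuple $R_i(\vec c)$ is identified with $\Delta_i(\vec c)$. Both semantics start with $R^0=D$ and $\Delta^0=\emptyset$. * End semantics: $\Delta^{t+1}=\Delta^t\cup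 P[D^t]$ and $R^{t+1}=R^0$. If $T$ is the first index with $D^T=D^{T+1}$, then $\mathrm{End}(P,D)=D\setminus(D\setminus\Delta^T)$, the set of tuples of $D$ whose delta tuple has been derived. * Stage semantics: $\Delta^{t+1}=\Delta^t\cup P[D^t]$ and $R^{t+1}=R^t\setminus\Delta^{t+1}$. If $T$ is the first index with $D^T=D^{T+1}$, then $\mathrm{Stage}(P,D)=D\setminus R^T$. (Such a $T$ exists for both semantics.) Proposition. For every fixed delta program $P$, both $\mathrm{End}(P,D)$ and $\mathrm{Stage}(P,D)$ can be computed from $D$ in polynomial time in the size of $D$ (data complexity): for each of the two there are a multi-stack Turing machine and a polynomial $p$, which may depend on $P$, the schema and the encoding of values, such that, given any listing without repetitions of the tuples of any database $D$, written as a string of length $n$, the machine halts within $p(n)$ steps, and its output is a listing without repetitions of the result. -/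

import Mathlib

namespace DeltaRules

/-- A relational schema `(R_1, …, R_k)`, each relation name with its number of attributes. -/
structure Schema where
  numRel : ℕ
  arity : Fin numRel → ℕ

/-- A tuple `R_i(c_1, …, c_n)` over the schema, with values in the domain `V`. -/
structure Fact (S : Schema) (V : Type) where
  rel : Fin S.numRel
  val : Fin (S.arity rel) → V

/-- Variables are named by natural numbers; a term is a variable or a constant. -/
inductive Term (V : Type) where
  | var (x : ℕ)
  | const (c : V)

/-- `R_i(Y)` with `Y` a vector of variables and constants. -/
structure Atom (S : Schema) (V : Type) where
  rel : Fin S.numRel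
  args : Fin (S.arity rel) → Term V

/-- A body atom: over a relation `R_i`, or over the delta relation `Δ_i`. -/
inductive BodyAtom (S : Schema) (V : Type) where
  | base (a : Atom S V)
  | delta (a : Atom S V)

/-- The delta rule `Δ_i(X) :- R_i(X), Q_1(Y_1), …, Q_l(Y_l)`, given by the vector `X` together with
its relation name (`head`) and the further body atoms `Q_1(Y_1), …, Q_l(Y_l)` (`rest`). -/
structure DeltaRule (S : Schema) (V : Type) where
  head : Atom S V
  rest : List (BodyAtom S V)

/-- The body of a delta rule, which always contains `R_i(X)`. -/
def DeltaRule.body {S : Schema} {V : Type} (r : DeltaRule S V) : List (BodyAtom S V) :=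
  BodyAtom.base r.head :: r.rest

/-- A delta program: a finite set of delta rules. -/
abbrev DeltaProgram (S : Schema) (V : Type) := Finset (DeltaRule S V)

/-- A database instance: a finite set of tuples over the schema. -/
abbrev Database (S : Schema) (V : Type) := Finset (Fact S V)

/-- The value of a term: variables by the assignment `α`, constants by themselves. -/
def Term.eval {V : Type} (α : ℕ → V) : Term V → V
  | .var x => α x
  | .const c => c

/-- The tuple obtained from an atom by applying the assignment `α`. -/
def Atom.eval {S : Schema} {V : Type} (α : ℕ → V) (a : Atom S V) : Fact S V :=
  ⟨a.rel, fun j => (a.args j).eval α⟩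

/-- A state of the evaluation: the contents of the relations `R_1, …, R_k` (`base`) and of the delta
relations `Δ_1, …, Δ_k` (`delta`; the element `R_i(c)` of `delta` stands for `Δ_i(c)`). -/
@[ext]
structure State (S : Schema) (V : Type) where
  base : Set (Fact S V)
  delta : Set (Fact S V)

/-- The assignment `α` maps the body atom into the state `s`. -/
def BodyAtom.Holds {S : Schema} {V : Type} (s : State S V) (α : ℕ → V) : BodyAtom S V → Prop
  | .base a => a.eval α ∈ s.base
  | .delta a => a.eval α ∈ s.delta

/-- All tuples `α(head(r))` for rules `r` of `P` and assignments `α` of the body of `r` into `s`. -/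
def derived {S : Schema} {V : Type} (P : DeltaProgram S V) (s : State S V) : Set (Fact S V) :=
  {t | ∃ r ∈ P, ∃ α : ℕ → V, (∀ q ∈ r.body, q.Holds s α) ∧ t = r.head.eval α}

/-- The state at the start: the relations of `D`, and empty delta relations. -/
def initState {S : Schema} {V : Type} (D : Database S V) : State S V :=
  ⟨↑D, ∅⟩

/-- The states `D^t` under end semantics: only the delta relations are updated. -/
def endState {S : Schema} {V : Type} (P : DeltaProgram S V) (D : Database S V) : ℕ → State S V
  | 0 => initState D
  | t + 1 =>
    ⟨(initState D).base, (endState P D t).delta ∪ derived P (endState P D t)⟩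

/-- The states `D^t` under stage semantics: `Δ^{t+1} = Δ^t ∪ derived`, `R^{t+1} = R^t \ Δ^{t+1}`. -/
def stageState {S : Schema} {V : Type} (P : DeltaProgram S V) (D : Database S V) : ℕ → State S V
  | 0 => initState D
  | t + 1 =>
    ⟨(stageState P D t).base \ ((stageState P D t).delta ∪ derived P (stageState P D t)),
      (stageState P D t).delta ∪ derived P (stageState P D t)⟩

theorem derived_subset_base {S : Schema} {V : Type} (P : DeltaProgram S V) (s : State S V) :
    derived P s ⊆ s.base := by
  rintro t ⟨r, -, α, h, rfl⟩
  exact h (.base r.head) List.mem_cons_self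

theorem exists_eq_succ {α : Type} {D : Set α} (hD : D.Finite) (s : ℕ → Set α)
    (hm : ∀ t, s t ⊆ s (t + 1)) (hs : ∀ t, s t ⊆ D) : ∃ t, s t = s (t + 1) := by
  by_contra! h
  have hmono : StrictMono s :=
    strictMono_nat_of_lt_succ fun t => lt_of_le_of_ne (hm t) (h t)
  exact Set.infinite_of_injective_forall_mem hmono.injective (s := D.powerset)
    (fun t => hs t) hD.finite_subsets

theorem endState_base {S : Schema} {V : Type} (P : DeltaProgram S V) (D : Database S V) (t : ℕ) :
    (endState P D t).base = ↑D := by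
  cases t <;> rfl

theorem exists_end_fixpoint {S : Schema} {V : Type} (P : DeltaProgram S V) (D : Database S V) :
    ∃ t, endState P D t = endState P D (t + 1) := by
  obtain ⟨t, ht⟩ := exists_eq_succ D.finite_toSet (fun t => (endState P D t).delta)
    (fun t => Set.subset_union_left) (fun t => by
      induction t with
      | zero => exact Set.empty_subset _
      | succ t ih =>
        exact Set.union_subset ih
          ((derived_subset_base P _).trans (endState_base P D t).subset))
  exact ⟨t, State.ext (by rw [endState_base, endState_base]) ht⟩

theorem stageState_base {S : Schema} {V : Type} (P : DeltaProgram S V) (D : Database S V) (t : ℕ) :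
    (stageState P D t).base = ↑D \ (stageState P D t).delta := by
  induction t with
  | zero => exact Set.sdiff_empty.symm
  | succ t ih =>
    simp only [stageState]
    rw [ih]
    ext x
    simp only [Set.mem_sdiff, Set.mem_union]
    tauto

theorem exists_stage_fixpoint {S : Schema} {V : Type} (P : DeltaProgram S V) (D : Database S V) :
    ∃ t, stageState P D t = stageState P D (t + 1) := by
  obtain ⟨t, ht⟩ := exists_eq_succ D.finite_toSet (fun t => (stageState P D t).delta)
    (fun t => Set.subset_union_left) (fun t => by
      induction t with
      | zero => exact Set.empty_subset _
      | succ t ih =>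
        exact Set.union_subset ih ((derived_subset_base P _).trans
          ((stageState_base P D t).subset.trans Set.sdiff_subset)))
  refine ⟨t, State.ext ?_ ht⟩
  rw [stageState_base, stageState_base]
  exact congrArg (fun x => (↑D : Set (Fact S V)) \ x) ht

open Classical in
/-- `End(P, D)`: at the fixpoint `T` the derived delta tuples are removed from the relations, and
the result is the set of non-delta tuples of `D` that are then missing. -/
noncomputable def endResult {S : Schema} {V : Type} (P : DeltaProgram S V) (D : Database S V) :
    Set (Fact S V) :=
  ↑D \ (↑D \ (endState P D (Nat.find (exists_end_fixpoint P D))).delta)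

open Classical in
/-- `Stage(P, D)`: the non-delta tuples of `D` that are missing in the fixpoint of the stages. -/
noncomputable def stageResult {S : Schema} {V : Type} (P : DeltaProgram S V) (D : Database S V) :
    Set (Fact S V) :=
  ↑D \ (stageState P D (Nat.find (exists_stage_fixpoint P D))).base

/-- The letters with which databases are written: relation names, the letters `A` in which the
values are written, and a separator that ends each value. -/
inductive Letter (S : Schema) (A : Type) where
  | rel (i : Fin S.numRel)
  | char (a : A)
  | sep

/-- A tuple is written as its relation name, followed by its values, each with a separator behind it. -/
def encodeFact {S : Schema} {V A : Type} (e : Computability.Encoding V A) (t : Fact S V) :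
    List (Letter S A) :=
  Letter.rel t.rel :: (List.ofFn t.val).flatMap fun v => (e.encode v).map Letter.char ++ [Letter.sep]

/-- A listing of a finite set of tuples, in any order and without repetitions. -/
abbrev Listing (S : Schema) (V : Type) := {L : List (Fact S V) // L.Nodup}

/-- The finite set of tuples that is listed. -/
def Listing.toDatabase {S : Schema} {V : Type} (L : Listing S V) : Database S V :=
  ⟨(L.1 : Multiset (Fact S V)), Multiset.coe_nodup.2 L.2⟩

/-- A listing is written by writing its tuples one after the other. -/
def encodeListing {S : Schema} {V A : Type} (e : Computability.Encoding V A) (L : Listing S V) :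
    List (Letter S A) :=
  L.1.flatMap (encodeFact e)

/-- `F` is computable in polynomial time: some Turing machine, given any listing of a database `D`,
halts with a listing of `F D` after a number of steps that is polynomial in the input length. -/
def PolyTimeComputable {S : Schema} {V A : Type} (e : Computability.Encoding V A)
    (F : Database S V → Set (Fact S V)) : Prop :=
  ∃ f : Listing S V → Listing S V,
    (∀ L, (↑(f L).toDatabase : Set (Fact S V)) = F L.toDatabase) ∧
    Nonempty (Turing.TM2ComputableInPolyTime (encodeListing e) (encodeListing e) f)

end DeltaRules

/-! Under stage semantics `R^t = D \ Δ^t`, so both evaluations are determined by the delta tuples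
alone, and they differ only in whether a base atom must also avoid `Δ^t`. One program with a flag
`stage` serves both. The sets `Δ^t` lie in `D` and grow strictly until the fixpoint, which is
therefore reached within `|D|` rounds and then kept; both results equal `Δ^n` for every `n ≥ |D|`
(`evalState_eq_fixpoint`, `endResult_eq`, `stageResult_eq`). The input length is such an `n`, so a
copy of the input counts the rounds and no fixpoint test is needed.

A round works on strings only. Relation letters occur only at the start of a tuple and separators
end the values, so a tuple is listed iff its string is a contiguous part of the string of the
listing (`writeFact_infix_iff`); membership is substring search. Values are not parsed: each of the
finitely many variables of `P` runs through the nonempty suffixes of the input and denotes the run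
of value letters at the front. Every value in `D` arises in this way, and strings that encode no
value do no harm, since no atom containing them matches a tuple (`mem_derived_iff`). With `m + 1`
variables there are at most `n ^ (m + 1)` choices.

For the time bound, delta tuples are stored without repetitions, so their stacks never exceed the
input length (`length_encodeFacts_le`), and one polynomial bounds all rounds. The machine is
assembled from fragments of stack programs whose effects and step bounds compose (`Runs`, `Adds`);
`runs_evaluate` is the outcome. -/

namespace StackProgram

/-! ### Structured programs for multi-stack machines, with step bounds -/

open Turing Function

/-- A program fragment of a `TM2` machine with stacks `K` over the alphabet `G`: a finite type of
labels and an entry label, with code that is parametric in the ambient label type and in the label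
at which execution continues. -/
structure Cmd (K G : Type) where
  Λ : Type
  fin : Fintype Λ
  entry : Λ
  code : ∀ {L : Type}, (Λ → L) → L → Λ → TM2.Stmt (fun _ : K => G) L (Option G)

variable {K G : Type} [DecidableEq K]

/-- The machine with program `M` goes from `c` to `c'` in exactly `t` steps. -/
def StepsTo {L : Type} (M : L → TM2.Stmt (fun _ : K => G) L (Option G)) (t : ℕ)
    (c c' : TM2.Cfg (fun _ : K => G) L (Option G)) : Prop :=
  (flip bind (TM2.step M))^[t] (some c) = some c'

theorem StepsTo.trans {L : Type} {M : L → TM2.Stmt (fun _ : K => G) L (Option G)} {t₁ t₂ : ℕ}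
    {a b c : TM2.Cfg (fun _ : K => G) L (Option G)} (h₁ : StepsTo M t₁ a b)
    (h₂ : StepsTo M t₂ b c) : StepsTo M (t₁ + t₂) a c := by
  unfold StepsTo at *
  rw [add_comm, iterate_add_apply, h₁, h₂]

theorem stepsTo_one {L : Type} {M : L → TM2.Stmt (fun _ : K => G) L (Option G)} {l : L}
    {v : Option G} {S : K → List G} {c : TM2.Cfg (fun _ : K => G) L (Option G)}
    (h : TM2.stepAux (M l) v S = c) : StepsTo M 1 ⟨some l, v, S⟩ c :=
  congrArg some h

/-- The fragment `c`, entered with stacks `S`, is left with stacks `S'` after at most `T` steps. -/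
structure Runs (c : Cmd K G) (S S' : K → List G) (T : ℕ) : Prop where
  stepsTo : ∀ {L : Type} (M : L → TM2.Stmt (fun _ : K => G) L (Option G)) (emb : c.Λ → L) (exit : L),
    (∀ x, M (emb x) = c.code emb exit x) →
      ∃ t ≤ T, StepsTo M t ⟨some (emb c.entry), none, S⟩ ⟨some exit, none, S'⟩

theorem Runs.mono {c : Cmd K G} {S S' : K → List G} {T T' : ℕ} (h : Runs c S S' T)
    (hT : T ≤ T') : Runs c S S' T' where
  stepsTo M emb exit hM :=
    let ⟨t, ht, hs⟩ := h.stepsTo M emb exit hM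
    ⟨t, ht.trans hT, hs⟩

theorem Runs.congr {c : Cmd K G} {S S' S'' : K → List G} {T T' : ℕ} (h : Runs c S S' T)
    (hS : S'' = S') (hT : T ≤ T') : Runs c S S'' T' :=
  hS ▸ h.mono hT

/-- A fragment consisting of one statement. -/
def Cmd.atom (q : ∀ {L : Type}, TM2.Stmt (fun _ : K => G) L (Option G) →
    TM2.Stmt (fun _ : K => G) L (Option G)) : Cmd K G where
  Λ := Unit
  fin := inferInstance
  entry := ()
  code _ exit _ := q (.goto fun _ => exit)

theorem runs_atom {q : ∀ {L : Type}, TM2.Stmt (fun _ : K => G) L (Option G) →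
      TM2.Stmt (fun _ : K => G) L (Option G)} {S S' : K → List G}
    (h : ∀ {L : Type} (exit : L),
      TM2.stepAux (q (.goto fun _ => exit)) none S = ⟨some exit, none, S'⟩) :
    Runs (Cmd.atom q) S S' 1 where
  stepsTo M emb exit hM := ⟨1, le_rfl, stepsTo_one (by rw [hM]; exact h exit)⟩

/-- Do nothing. -/
def Cmd.skip : Cmd K G := Cmd.atom fun q => q

theorem runs_skip (S : K → List G) : Runs Cmd.skip S S 1 := runs_atom fun _ => rfl

/-- Push the letter `a`. -/
def Cmd.push (k : K) (a : G) : Cmd K G := Cmd.atom fun q => .push k (fun _ => a) q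

theorem runs_push (k : K) (a : G) (S : K → List G) :
    Runs (Cmd.push k a) S (update S k (a :: S k)) 1 := runs_atom fun _ => rfl

/-- Remove the topmost letter. -/
def Cmd.pop (k : K) : Cmd K G := Cmd.atom fun q => .pop k (fun _ _ => none) q

theorem runs_pop (k : K) (S : K → List G) :
    Runs (Cmd.pop k) S (update S k (S k).tail) 1 := runs_atom fun _ => rfl

section

variable [Inhabited G]

/-- Move the topmost letter of `i` to `j`. -/
def Cmd.move (i j : K) : Cmd K G := Cmd.atom fun q =>
  .pop i (fun _ o => o) (.push j (fun v => v.getD default) (.load (fun _ => none) q))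

theorem runs_move {i j : K} (hij : i ≠ j) {S : K → List G} {a : G} {l : List G}
    (h : S i = a :: l) :
    Runs (Cmd.move i j) S (update (update S i l) j (a :: S j)) 1 :=
  runs_atom fun _ => by simp [h, update_of_ne hij.symm]

/-- Move the topmost letter of `i` to both `j` and `k`. -/
def Cmd.moveTwo (i j k : K) : Cmd K G := Cmd.atom fun q =>
  .pop i (fun _ o => o) (.push j (fun v => v.getD default)
    (.push k (fun v => v.getD default) (.load (fun _ => none) q)))

theorem runs_moveTwo {i j k : K} (hij : i ≠ j) (hik : i ≠ k) (hjk : j ≠ k) {S : K → List G}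
    {a : G} {l : List G} (h : S i = a :: l) :
    Runs (Cmd.moveTwo i j k) S
      (update (update (update S i l) j (a :: S j)) k (a :: S k)) 1 :=
  runs_atom fun _ => by
    simp [h, update_of_ne hij.symm, update_of_ne hik.symm, update_of_ne hjk.symm]

open Classical in
/-- Remove the topmost letters of `i` and `j`; if they differ, push a letter on `k`. -/
noncomputable def Cmd.compare (i j k : K) : Cmd K G := Cmd.atom fun q =>
  .pop i (fun _ o => o) (.pop j (fun v o => if v = o then none else some default)
    (.branch Option.isSome (.push k (fun _ => default) (.load (fun _ => none) q)) q))

open Classical in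
theorem runs_compare {i j k : K} (hij : i ≠ j) (hik : i ≠ k) (hjk : j ≠ k) (S : K → List G) :
    Runs (Cmd.compare i j k) S (update (update (update S i (S i).tail) j (S j).tail) k
      (if (S i).head? = (S j).head? then S k else default :: S k)) 1 :=
  runs_atom fun _ => by
    by_cases h : (S i).head? = (S j).head?
    · simp [h, update_of_ne hij.symm, update_of_ne hik.symm, update_of_ne hjk.symm]
    · simp [h, update_of_ne hij.symm, update_of_ne hik.symm, update_of_ne hjk.symm]

end

/-- Sequential composition. -/
def Cmd.seq (c d : Cmd K G) : Cmd K G where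
  Λ := c.Λ ⊕ d.Λ
  fin := @instFintypeSum _ _ c.fin d.fin
  entry := .inl c.entry
  code emb exit := Sum.elim (c.code (emb ∘ .inl) (emb (.inr d.entry))) (d.code (emb ∘ .inr) exit)

theorem Runs.seq {c d : Cmd K G} {S S' S'' : K → List G} {T T' : ℕ} (h : Runs c S S' T)
    (h' : Runs d S' S'' T') : Runs (c.seq d) S S'' (T + T') := ⟨fun M emb exit hM => by
  obtain ⟨t, ht, hs⟩ := h.stepsTo M (emb ∘ .inl) (emb (.inr d.entry)) fun x => hM (.inl x)
  obtain ⟨t', ht', hs'⟩ := h'.stepsTo M (emb ∘ .inr) exit fun x => hM (.inr x)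
  exact ⟨t + t', add_le_add ht ht', hs.trans hs'⟩⟩

/-- Repeat `c` as long as the topmost letter of `k` exists and satisfies `p`. -/
def Cmd.whileTop (k : K) (p : G → Bool) (c : Cmd K G) : Cmd K G where
  Λ := Option c.Λ
  fin := @instFintypeOption _ c.fin
  entry := none
  code emb exit
    | none => .peek k (fun _ o => o) (.branch (fun v => v.any p)
        (.load (fun _ => none) (.goto fun _ => emb (some c.entry)))
        (.load (fun _ => none) (.goto fun _ => exit)))
    | some x => c.code (emb ∘ some) (emb none) x

theorem runs_whileTop_of_not {k : K} {p : G → Bool} (c : Cmd K G) {S : K → List G}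
    (h : (S k).head?.any p = false) : Runs (Cmd.whileTop k p c) S S 1 := ⟨fun M emb exit hM => by
  refine ⟨1, le_rfl, stepsTo_one ?_⟩
  rw [hM]
  simp [Cmd.whileTop, h]⟩

theorem Runs.whileTop {k : K} {p : G → Bool} {c : Cmd K G} {S S' S'' : K → List G} {T T' : ℕ}
    (h : (S k).head?.any p = true) (hc : Runs c S S' T)
    (hw : Runs (Cmd.whileTop k p c) S' S'' T') :
    Runs (Cmd.whileTop k p c) S S'' (1 + T + T') := ⟨fun M emb exit hM => by
  obtain ⟨t, ht, hs⟩ := hc.stepsTo M (emb ∘ some) (emb none) fun x => hM (some x)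
  obtain ⟨t', ht', hs'⟩ := hw.stepsTo M emb exit hM
  refine ⟨1 + t + t', by omega, StepsTo.trans (StepsTo.trans (stepsTo_one ?_) hs) hs'⟩
  rw [hM]
  simp [Cmd.whileTop, h]
  rfl⟩

/-- Run `c` if the stack `k` is empty, and `d` otherwise. -/
def Cmd.ifEmpty (k : K) (c d : Cmd K G) : Cmd K G where
  Λ := Option (c.Λ ⊕ d.Λ)
  fin := @instFintypeOption _ (@instFintypeSum _ _ c.fin d.fin)
  entry := none
  code emb exit
    | none => .peek k (fun _ o => o) (.branch Option.isNone
        (.load (fun _ => none) (.goto fun _ => emb (some (.inl c.entry))))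
        (.load (fun _ => none) (.goto fun _ => emb (some (.inr d.entry)))))
    | some (.inl x) => c.code (emb ∘ some ∘ .inl) exit x
    | some (.inr x) => d.code (emb ∘ some ∘ .inr) exit x

theorem Runs.ifEmpty_of_eq {k : K} {c : Cmd K G} (d : Cmd K G) {S S' : K → List G} {T : ℕ}
    (h : S k = []) (hc : Runs c S S' T) : Runs (Cmd.ifEmpty k c d) S S' (1 + T) :=
  ⟨fun M emb exit hM => by
    obtain ⟨t, ht, hs⟩ := hc.stepsTo M (emb ∘ some ∘ .inl) exit fun x => hM (some (.inl x))
    refine ⟨1 + t, by omega, (stepsTo_one ?_).trans hs⟩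
    rw [hM]
    simp [Cmd.ifEmpty, h]
    rfl⟩

theorem Runs.ifEmpty_of_ne {k : K} (c : Cmd K G) {d : Cmd K G} {S S' : K → List G} {T : ℕ}
    (h : S k ≠ []) (hd : Runs d S S' T) : Runs (Cmd.ifEmpty k c d) S S' (1 + T) :=
  ⟨fun M emb exit hM => by
    obtain ⟨t, ht, hs⟩ := hd.stepsTo M (emb ∘ some ∘ .inr) exit fun x => hM (some (.inr x))
    refine ⟨1 + t, by omega, (stepsTo_one ?_).trans hs⟩
    obtain ⟨a, l, h⟩ := List.exists_cons_of_ne_nil h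
    rw [hM]
    simp [Cmd.ifEmpty, h]
    rfl⟩

/-- The Turing machine that runs a fragment and halts. -/
def Cmd.toFinTM2 [Fintype K] [Fintype G] (c : Cmd K G) (i o : K) : FinTM2 where
  K := K
  k₀ := i
  k₁ := o
  Γ _ := G
  Λ := Option c.Λ
  main := some c.entry
  ΛFin := @instFintypeOption _ c.fin
  σ := Option G
  initialState := none
  m
    | none => .halt
    | some x => c.code some none x

/-- `initList` and `haltList` give their stacks by a case distinction with a cast along `k = i`;
this brings them into the form used by `Runs`. -/
theorem dite_eq_update (i k : K) (x : List G) (f : k = i → List G) (hf : ∀ h, f h = x) :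
    (if h : k = i then f h else []) = update (fun _ => []) i x k := by
  by_cases h : k = i
  · subst h
    simp [hf]
  · simp [h]

/-- The additional step executes `halt` at the label `none`, the exit of the fragment. -/
theorem Runs.outputs [Fintype K] [Fintype G] {c : Cmd K G} {i o : K} {x y : List G} {T : ℕ}
    (h : Runs c (update (fun _ => []) i x) (update (fun _ => []) o y) T) :
    Nonempty (TM2OutputsInTime (c.toFinTM2 i o) x (some y) (T + 1)) := by
  obtain ⟨t, ht, hs⟩ := h.stepsTo (c.toFinTM2 i o).m some none fun _ => rfl
  have hs' : StepsTo (c.toFinTM2 i o).m 1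
      ⟨some none, none, update (fun _ => []) o y⟩ ⟨none, none, update (fun _ => []) o y⟩ :=
    stepsTo_one rfl
  have hi : initList (c.toFinTM2 i o) x = ⟨some (some c.entry), none, update (fun _ => []) i x⟩ :=
    congrArg (TM2.Cfg.mk _ _) (funext fun k => dite_eq_update i k x _ fun _ => rfl)
  have ho : haltList (c.toFinTM2 i o) y = ⟨none, none, update (fun _ => []) o y⟩ :=
    congrArg (TM2.Cfg.mk _ _) (funext fun k => dite_eq_update o k y _ fun _ => rfl)
  refine ⟨⟨⟨t + 1, ?_⟩, Nat.succ_le_succ ht⟩⟩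
  exact Eq.trans (congrArg _ (congrArg some hi)) (Eq.trans (hs.trans hs') (congrArg some ho.symm))

end StackProgram

/-! ### Clearing, moving, copying and comparing stacks -/

namespace StackProgram

open Function

section Macros

variable {K G : Type} [DecidableEq K]

/-- Empty the stack `k`. -/
def Cmd.clear (k : K) : Cmd K G := Cmd.whileTop k (fun _ => true) (Cmd.pop k)

theorem runs_clear (k : K) (S : K → List G) :
    Runs (Cmd.clear k) S (update S k []) (2 * (S k).length + 1) := by
  induction h : S k generalizing S with
  | nil =>
    have h' : update S k [] = S := by rw [← h, update_eq_self]
    rw [h']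
    exact (runs_whileTop_of_not _ (by simp [h])).mono (by simp)
  | cons a l ih =>
    have h₂ := ih (update S k (S k).tail) (by simp [h])
    rw [update_idem] at h₂
    exact (Runs.whileTop (by simp [h]) (runs_pop k S) h₂).mono (by simp; omega)

variable [Inhabited G]

theorem runs_moveWhile {i j : K} (hij : i ≠ j) (p : G → Bool) (S : K → List G) :
    Runs (Cmd.whileTop i p (Cmd.move i j)) S
      (update (update S i ((S i).dropWhile p)) j (((S i).takeWhile p).reverse ++ S j))
      (2 * (S i).length + 1) := by
  induction h : S i generalizing S with
  | nil =>
    have h' : update (update S i ([].dropWhile p)) j (([].takeWhile p).reverse ++ S j) = S := by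
      funext k
      by_cases hk : k = j
      · simp [hk]
      · by_cases hk' : k = i
        · simp [hk', hij, h]
        · simp [hk, hk']
    rw [h']
    exact (runs_whileTop_of_not _ (by simp [h])).mono (by simp)
  | cons a l ih =>
    by_cases ha : p a
    · have h₂ := ih (update (update S i l) j (a :: S j)) (by simp [hij])
      refine (Runs.whileTop (by simp [h, ha]) (runs_move hij h) ?_).mono
        (T := 1 + 1 + (2 * l.length + 1)) (by simp; omega)
      convert h₂ using 1
      funext k
      by_cases hk : k = j
      · simp [hk, ha]
      · by_cases hk' : k = i
        · simp [hk', hij, ha]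
        · simp [hk, hk']
    · have h' : update (update S i ((a :: l).dropWhile p)) j
          (((a :: l).takeWhile p).reverse ++ S j) = S := by
        funext k
        by_cases hk : k = j
        · simp [hk, ha]
        · by_cases hk' : k = i
          · simp [hk', hij, h, ha]
          · simp [hk, hk']
      rw [h']
      exact (runs_whileTop_of_not _ (by simp [h, ha])).mono (by simp)

theorem runs_moveTwoAll {i j k : K} (hij : i ≠ j) (hik : i ≠ k) (hjk : j ≠ k) (S : K → List G) :
    Runs (Cmd.whileTop i (fun _ => true) (Cmd.moveTwo i j k)) S
      (update (update (update S i []) j ((S i).reverse ++ S j)) k ((S i).reverse ++ S k))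
      (2 * (S i).length + 1) := by
  induction h : S i generalizing S with
  | nil =>
    have h' : update (update (update S i []) j (List.reverse [] ++ S j)) k
        (List.reverse [] ++ S k) = S := by
      funext x
      by_cases hx : x = k
      · simp [hx]
      · by_cases hx' : x = j
        · simp [hx', hjk]
        · by_cases hx'' : x = i
          · simp [hx'', hij, hik, h]
          · simp [hx, hx', hx'']
    rw [h']
    exact (runs_whileTop_of_not _ (by simp [h])).mono (by simp)
  | cons a l ih =>
    have h₂ := ih (update (update (update S i l) j (a :: S j)) k (a :: S k)) (by simp [hij, hik])
    refine (Runs.whileTop (by simp [h]) (runs_moveTwo hij hik hjk h) ?_).mono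
        (T := 1 + 1 + (2 * l.length + 1)) (by simp; omega)
    convert h₂ using 1
    funext x
    by_cases hx : x = k
    · simp [hx]
    · by_cases hx' : x = j
      · simp [hx', hjk]
      · by_cases hx'' : x = i
        · simp [hx'', hij, hik]
        · simp [hx, hx', hx'']

/-- Put a copy of the longest prefix of `i` with letters in `p` on top of `j`. -/
def Cmd.copyWhile (tmp : K) (p : G → Bool) (i j : K) : Cmd K G :=
  (Cmd.whileTop i p (Cmd.move i tmp)).seq
    (Cmd.whileTop tmp (fun _ => true) (Cmd.moveTwo tmp i j))

/-- Moving the prefix to `tmp` reverses it, and moving it from there to both `i` and `j` reverses it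
again; this restores `i`. -/
theorem runs_copyWhile {tmp i j : K} (hi : i ≠ tmp) (hj : j ≠ tmp) (hij : i ≠ j) (p : G → Bool)
    {S : K → List G} (hS : S tmp = []) :
    Runs (Cmd.copyWhile tmp p i j) S (update S j ((S i).takeWhile p ++ S j))
      (4 * (S i).length + 2) := by
  have h := (runs_moveWhile hi p S).seq (runs_moveTwoAll hi.symm hj.symm hij _)
  have hl : ((S i).takeWhile p).length ≤ (S i).length := (List.takeWhile_prefix p).length_le
  refine h.congr ?_ ?_
  · funext x
    by_cases hx : x = j
    · simp [hx, hS, hj, hij.symm]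
    · by_cases hx' : x = tmp
      · simp [hx', hS, hj.symm, hi.symm]
      · by_cases hx'' : x = i
        · simp [hx'', hS, hij, hi]
        · simp [hx, hx', hx'']
  · simp [hS]
    omega

-- Each mismatch, including the case that `j` is exhausted first, leaves a mark on `k`, so an empty
-- `k` at the end certifies a prefix. The bound on `d` limits the time for clearing the marks.
open Classical in
theorem runs_compareAll {i j k : K} (hij : i ≠ j) (hik : i ≠ k) (hjk : j ≠ k) (S : K → List G) :
    ∃ d : List G, (d = [] ↔ S k = [] ∧ S i <+: S j) ∧ d.length ≤ (S k).length + (S i).length ∧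
      Runs (Cmd.whileTop i (fun _ => true) (Cmd.compare i j k)) S
        (update (update (update S i []) j ((S j).drop (S i).length)) k d)
        (2 * (S i).length + 1) := by
  induction h : S i generalizing S with
  | nil =>
    refine ⟨S k, by simp, by simp, ?_⟩
    have h' : update (update (update S i []) j ((S j).drop ([] : List G).length)) k (S k) = S := by
      rw [show update S i [] = S by rw [← h, update_eq_self]]
      simp
    rw [h']
    exact (runs_whileTop_of_not _ (by simp [h])).mono (by simp)
  | cons a l ih =>
    have h₁ := runs_compare hij hik hjk S
    obtain ⟨d, hd, hl, h₂⟩ := ih _ (show (update (update (update S i (S i).tail) j (S j).tail) k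
      (if (S i).head? = (S j).head? then S k else default :: S k)) i = l by simp [hij, hik, h])
    refine ⟨d, hd.trans ?_, ?_, ?_⟩
    · cases hb : S j with
      | nil => simp [h, hjk]
      | cons b m =>
        by_cases hab : a = b
        · simp [h, hjk, hab, List.cons_prefix_cons]
        · simp [h, hjk, hab, List.cons_prefix_cons]
    · refine hl.trans ?_
      simp only [update_self]
      split_ifs
      · simp
      · simp
        omega
    · refine (Runs.whileTop (by simp [h]) h₁ ?_).mono
        (T := 1 + 1 + (2 * l.length + 1)) (by simp; omega)
      convert h₂ using 1
      funext x
      by_cases hx : x = k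
      · simp [hx]
      · by_cases hx' : x = j
        · simp [hx', hjk]
        · by_cases hx'' : x = i
          · simp [hx'', hij, hik]
          · simp [hx, hx', hx'']

end Macros

/-- The stacks: the database `inp`, the delta tuples `del` of the present state and `new` of the next
one, a counter `cnt` of rounds, the values `val x` of the variables, a tuple `w` to be tested, the
result `hit` of the test (nonempty if successful), and auxiliary stacks. -/
inductive Reg (m : ℕ)
  | inp | del | new | cnt | w | hit | tmp | r | w₂ | r₂ | ne
  | val (x : Fin m)
  deriving DecidableEq, Fintype

/-! ### Substring search -/

section Infix

theorem takeWhile_const_true {G : Type} (l : List G) : l.takeWhile (fun _ => true) = l := by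
  simp

variable {m : ℕ} {G : Type} [Inhabited G]

/-- Test whether `w` is a prefix of `r`. -/
noncomputable def testPrefix : Cmd (Reg m) G :=
  (Cmd.copyWhile .tmp (fun _ => true) .w .w₂).seq <|
  (Cmd.copyWhile .tmp (fun _ => true) .r .r₂).seq <|
  (Cmd.whileTop .w₂ (fun _ => true) (Cmd.compare .w₂ .r₂ .ne)).seq <|
  (Cmd.clear .r₂).seq <|
  Cmd.ifEmpty .ne (Cmd.push .hit default) (Cmd.clear .ne)

/-- The comparison consumes copies, so `w` and `r` survive. Success adds a letter to `hit` and
failure leaves it alone, so repeated tests accumulate a disjunction. -/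
theorem runs_testPrefix {S : Reg m → List G} (ht : S .tmp = []) (hw : S .w₂ = [])
    (hr : S .r₂ = []) (hn : S .ne = []) :
    ∃ h : List G, (h ≠ [] ↔ S .hit ≠ [] ∨ S .w <+: S .r) ∧ h.length ≤ (S .hit).length + 1 ∧
      Runs testPrefix S (update S .hit h) (8 * (S .w).length + 6 * (S .r).length + 8) := by
  have h₁ := runs_copyWhile (tmp := Reg.tmp) (i := .w) (j := .w₂) (by simp) (by simp) (by simp)
    (fun _ => true) ht
  rw [takeWhile_const_true, hw, List.append_nil] at h₁
  set S₁ := update S .w₂ (S .w) with hS₁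
  have h₂ := runs_copyWhile (tmp := Reg.tmp) (i := .r) (j := .r₂) (by simp) (by simp) (by simp)
    (fun _ => true) (S := S₁) (by simp [hS₁, ht])
  rw [takeWhile_const_true, show S₁ .r₂ = [] by simp [hS₁, hr], List.append_nil,
    show S₁ .r = S .r by simp [hS₁]] at h₂
  set S₂ := update S₁ .r₂ (S .r) with hS₂
  obtain ⟨d, hd, hl, h₃⟩ := runs_compareAll (i := Reg.w₂) (j := .r₂) (k := .ne) (by simp) (by simp)
    (by simp) S₂
  have e₁ : S₂ .w₂ = S .w := by simp [hS₂, hS₁]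
  have e₂ : S₂ .r₂ = S .r := by simp [hS₂]
  have e₃ : S₂ .ne = [] := by simp [hS₂, hS₁, hn]
  rw [e₁, e₂, e₃] at hd
  rw [e₁, e₃] at hl
  rw [e₁, e₂] at h₃
  set S₃ := update (update (update S₂ .w₂ []) .r₂ ((S .r).drop (S .w).length)) .ne d with hS₃
  have h₄ := runs_clear Reg.r₂ S₃
  rw [show S₃ .r₂ = (S .r).drop (S .w).length by simp [hS₃]] at h₄
  set S₄ := update S₃ .r₂ [] with hS₄
  have e₄ : S₄ .ne = d := by simp [hS₄, hS₃]
  by_cases hd' : d = []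
  · have h₅ := Runs.ifEmpty_of_eq (Cmd.clear .ne) (e₄.trans hd')
      (runs_push Reg.hit (default : G) S₄)
    refine ⟨default :: S .hit, ?_, by simp, ?_⟩
    · simp [(hd.1 hd').2]
    · refine (h₁.seq (h₂.seq (h₃.seq (h₄.seq h₅)))).congr ?_ ?_
      · funext x
        cases x <;> simp [hS₄, hS₃, hS₂, hS₁, hd', ht, hw, hr, hn]
      · simp
        omega
  · have h₅ := Runs.ifEmpty_of_ne (Cmd.push .hit default) (k := Reg.ne) (S := S₄)
      (by rwa [e₄]) (runs_clear Reg.ne S₄)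
    refine ⟨S .hit, ?_, by simp, ?_⟩
    · have : ¬ S .w <+: S .r := fun h => hd' (hd.2 ⟨rfl, h⟩)
      simp [this]
    · refine (h₁.seq (h₂.seq (h₃.seq (h₄.seq h₅)))).congr ?_ ?_
      · funext x
        cases x <;> simp [hS₄, hS₃, hS₂, hS₁, ht, hw, hr, hn]
      · rw [e₄]
        simp at hl ⊢
        omega

/-- Test whether `w` is a contiguous part of `X`. -/
noncomputable def testInfix (X : Reg m) : Cmd (Reg m) G :=
  (Cmd.copyWhile .tmp (fun _ => true) X .r).seq
    (Cmd.whileTop .r (fun _ => true) (testPrefix.seq (Cmd.pop .r)))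

/-- A contiguous part is a prefix of a suffix. The loop never tests the empty suffix, hence the
condition `S .w ≠ []`. The fixed bound `R` keeps the cost of a pass constant while `r` shrinks. -/
theorem runs_testSuffixes {S : Reg m → List G} (ht : S .tmp = []) (hw : S .w₂ = [])
    (hr : S .r₂ = []) (hn : S .ne = []) (hW : S .w ≠ []) {R : ℕ} (hR : (S .r).length ≤ R) :
    ∃ h : List G, (h ≠ [] ↔ S .hit ≠ [] ∨ S .w <:+: S .r) ∧
      h.length ≤ (S .hit).length + (S .r).length ∧
      Runs (Cmd.whileTop .r (fun _ => true) (testPrefix.seq (Cmd.pop .r))) S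
        (update (update S .r []) .hit h)
        ((S .r).length * (8 * (S .w).length + 6 * R + 10) + 1) := by
  induction h : S .r generalizing S with
  | nil =>
    refine ⟨S .hit, by simp [hW], by simp, ?_⟩
    have h' : update (update S .r []) .hit (S .hit) = S := by
      rw [← h]
      simp
    rw [h']
    exact (runs_whileTop_of_not _ (by simp [h])).mono (by simp)
  | cons a l ih =>
    obtain ⟨h₁, hh₁, hl₁, hr₁⟩ := runs_testPrefix ht hw hr hn
    have hp := runs_pop Reg.r (update S .hit h₁)
    set S₁ := update (update S .hit h₁) .r ((update S .hit h₁) .r).tail with hS₁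
    obtain ⟨h₂, hh₂, hl₂, hr₂⟩ := ih (S := S₁) (by simp [hS₁, ht]) (by simp [hS₁, hw])
      (by simp [hS₁, hr]) (by simp [hS₁, hn]) (by simp [hS₁, hW])
      (by rw [h] at hR; simp [hS₁, h] at hR ⊢; omega) (by simp [hS₁, h])
    have e₁ : S₁ .w = S .w := by simp [hS₁]
    have e₂ : S₁ .hit = h₁ := by simp [hS₁]
    rw [e₁, e₂] at hh₂
    rw [e₂] at hl₂
    rw [e₁] at hr₂
    refine ⟨h₂, ?_, ?_, ?_⟩
    · rw [hh₂, hh₁, h, List.infix_cons_iff, or_assoc]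
    · rw [List.length_cons]
      omega
    · refine (Runs.whileTop (by simp [h]) (hr₁.seq hp) hr₂).congr ?_ ?_
      · funext x
        cases x <;> simp [hS₁]
      · rw [h, List.length_cons] at hR ⊢
        rw [add_mul]
        omega

theorem runs_testInfix {S : Reg m → List G} (ht : S .tmp = []) (hw : S .w₂ = [])
    (hr : S .r₂ = []) (hn : S .ne = []) (hr' : S .r = []) (hh : S .hit = []) (hW : S .w ≠ [])
    {X : Reg m} (hX : X ≠ .tmp) (hX' : X ≠ .r) :
    ∃ h : List G, (h ≠ [] ↔ S .w <:+: S X) ∧ h.length ≤ (S X).length ∧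
      Runs (testInfix X) S (update S .hit h)
        ((S X).length * (8 * (S .w).length + 6 * (S X).length + 14) + 3) := by
  have h₁ := runs_copyWhile (tmp := Reg.tmp) (i := X) (j := .r) hX (by simp) hX' (fun _ => true) ht
  rw [takeWhile_const_true, hr', List.append_nil] at h₁
  obtain ⟨h, hh', hl, h₂⟩ := runs_testSuffixes (S := update S .r (S X)) (by simp [ht]) (by simp [hw])
    (by simp [hr]) (by simp [hn]) (by simp [hW]) (R := (S X).length) (by simp)
  refine ⟨h, ?_, ?_, ?_⟩
  · rw [hh']
    simp [hh]
  · simpa [hh] using hl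
  · refine (h₁.seq h₂).congr ?_ ?_
    · funext x
      cases x <;> simp [hr']
    · simp
      ring_nf
      omega

end Infix

end StackProgram

/-! ### Tuples as strings, and derivation as string matching -/

namespace DeltaRules

section Strings

variable {S : Schema} {V A : Type}

/-- The letters in which values are written. -/
def Letter.isChar : Letter S A → Bool
  | .char _ => true
  | _ => false

/-- The value that is written at the beginning of a string. -/
def block : List (Letter S A) → List A
  | .char a :: l => a :: block l
  | _ => []

theorem takeWhile_isChar (l : List (Letter S A)) :
    l.takeWhile Letter.isChar = (block l).map Letter.char := by
  induction l with
  | nil => rfl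
  | cons a l ih => cases a <;> simp [block, List.takeWhile_cons, Letter.isChar, ih]

theorem block_append (b : List A) (l : List (Letter S A)) :
    block (b.map Letter.char ++ Letter.sep :: l) = b := by
  induction b with
  | nil => rfl
  | cons a b ih => simp [block, ih]

/-- Strings over the alphabet of values, each with a separator behind it. -/
def writeBlocks (S : Schema) (bs : List (List A)) : List (Letter S A) :=
  bs.flatMap fun b => b.map Letter.char ++ [Letter.sep]

/-- A relation name followed by strings. -/
def writeFact (i : Fin S.numRel) (bs : List (List A)) : List (Letter S A) :=
  Letter.rel i :: writeBlocks S bs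

theorem writeBlocks_cons (b : List A) (bs : List (List A)) :
    writeBlocks S (b :: bs) = b.map Letter.char ++ Letter.sep :: writeBlocks S bs := by
  simp [writeBlocks]

/-- No value letter equals the separator, so the first separators of both strings stand at the same
place. -/
theorem map_char_prefix {b b' : List A} {l l' : List (Letter S A)}
    (h : b.map Letter.char ++ Letter.sep :: l <+: b'.map Letter.char ++ Letter.sep :: l') :
    b = b' ∧ l <+: l' := by
  induction b generalizing b' with
  | nil =>
    cases b' with
    | nil => simpa [List.cons_prefix_cons] using h
    | cons a b' => simp [List.cons_prefix_cons] at h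
  | cons a b ih =>
    cases b' with
    | nil => simp [List.cons_prefix_cons] at h
    | cons a' b' =>
      simp only [List.map_cons, List.cons_append, List.cons_prefix_cons, Letter.char.injEq] at h
      obtain ⟨h₁, h₂⟩ := ih h.2
      exact ⟨by rw [h.1, h₁], h₂⟩

theorem writeBlocks_prefix {bs bs' : List (List A)} {l : List (Letter S A)}
    (hl : bs.length = bs'.length) (h : writeBlocks S bs <+: writeBlocks S bs' ++ l) : bs = bs' := by
  induction bs generalizing bs' with
  | nil => exact (List.length_eq_zero_iff.1 hl.symm).symm
  | cons b bs ih =>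
    cases bs' with
    | nil => simp at hl
    | cons b' bs' =>
      rw [writeBlocks_cons, writeBlocks_cons, List.append_assoc, List.cons_append] at h
      obtain ⟨h₁, h₂⟩ := map_char_prefix h
      rw [h₁, ih (by simpa using hl) h₂]

/-- An occurrence begins with a relation letter, so it cannot begin inside `v`. -/
theorem infix_of_append {i : Fin S.numRel} {u v y : List (Letter S A)}
    (hv : ∀ j, Letter.rel j ∉ v) (h : Letter.rel i :: u <:+: v ++ y) : Letter.rel i :: u <:+: y := by
  induction v with
  | nil => exact h
  | cons a v ih =>
    rw [List.cons_append, List.infix_cons_iff, List.cons_prefix_cons] at h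
    rcases h with ⟨rfl, -⟩ | h
    · exact absurd List.mem_cons_self (hv i)
    · exact ih (fun j hj => hv j (List.mem_cons_of_mem _ hj)) h

variable (e : Computability.Encoding V A)

theorem encodeFact_eq (t : Fact S V) :
    encodeFact e t = writeFact t.rel ((List.ofFn t.val).map e.encode) := by
  simp only [encodeFact, writeFact, writeBlocks, List.flatMap_map]

/-- The string of a list of tuples. -/
def encodeFacts (L : List (Fact S V)) : List (Letter S A) :=
  L.flatMap (encodeFact e)

/-- An occurrence can only begin at the relation letter of a listed tuple. The relation fixes the
number of values on both sides, and the separators then force the values to agree. -/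
theorem writeFact_infix_iff {i : Fin S.numRel} {bs : List (List A)} (hbs : bs.length = S.arity i)
    (L : List (Fact S V)) :
    writeFact i bs <:+: encodeFacts e L ↔ ∃ t ∈ L, encodeFact e t = writeFact i bs := by
  constructor
  · intro h
    induction L with
    | nil => simp [encodeFacts, writeFact] at h
    | cons t L ih =>
      rw [encodeFacts, List.flatMap_cons, encodeFact_eq, writeFact, writeFact, List.cons_append,
        List.infix_cons_iff, List.cons_prefix_cons, Letter.rel.injEq] at h
      rcases h with ⟨h₁, h₂⟩ | h
      · refine ⟨t, List.mem_cons_self, ?_⟩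
        rw [encodeFact_eq, h₁, writeBlocks_prefix (by simp [hbs, h₁]) h₂]
      · obtain ⟨t', ht', h'⟩ := ih (infix_of_append (by simp [writeBlocks]) h)
        exact ⟨t', List.mem_cons_of_mem _ ht', h'⟩
  · rintro ⟨t, ht, h⟩
    rw [← h]
    obtain ⟨L₁, L₂, rfl⟩ := List.append_of_mem ht
    exact ⟨encodeFacts e L₁, encodeFacts e L₂, by simp [encodeFacts]⟩

theorem encodeFact_injective : Function.Injective (encodeFact (S := S) e) := by
  rintro ⟨i, v⟩ ⟨i', v'⟩ h
  rw [encodeFact_eq, encodeFact_eq, writeFact, writeFact, List.cons.injEq, Letter.rel.injEq] at h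
  obtain ⟨h₁, h₂⟩ := h
  dsimp only at h₁
  subst h₁
  have h₃ : (List.ofFn v).map e.encode = (List.ofFn v').map e.encode :=
    writeBlocks_prefix (l := []) (by simp) (by rw [List.append_nil, h₂])
  rw [List.map_injective_iff.2 e.encode_injective |>.eq_iff, List.ofFn_inj] at h₃
  exact congrArg _ h₃

theorem encodeFact_ne_nil (t : Fact S V) : encodeFact e t ≠ [] := by
  simp [encodeFact]

/-- The suffix that begins at the value itself. It is nonempty even if the value has an empty code,
because a separator follows. -/
theorem exists_suffix_block {t : Fact S V} {L : List (Fact S V)} (ht : t ∈ L)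
    (j : Fin (S.arity t.rel)) :
    ∃ s, s ≠ [] ∧ s <:+ encodeFacts e L ∧ block s = e.encode (t.val j) := by
  obtain ⟨L₁, L₂, rfl⟩ := List.append_of_mem ht
  obtain ⟨l₁, l₂, hl⟩ := List.append_of_mem ((List.mem_ofFn' t.val _).2 ⟨j, rfl⟩)
  refine ⟨(e.encode (t.val j)).map Letter.char ++ Letter.sep ::
    (writeBlocks S (l₂.map e.encode) ++ encodeFacts e L₂), by simp, ?_, block_append _ _⟩
  refine ⟨encodeFacts e L₁ ++ Letter.rel t.rel :: writeBlocks S (l₁.map e.encode), ?_⟩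
  simp [encodeFacts, encodeFact_eq, writeFact, hl, writeBlocks]

/-- Without repetitions, `L` is a sublist of `L'` up to order. This keeps all stacks of delta tuples
within the input length. -/
theorem length_encodeFacts_le {L L' : List (Fact S V)} (h : L.Nodup) (hs : L ⊆ L') :
    (encodeFacts e L).length ≤ (encodeFacts e L').length := by
  obtain ⟨l, hp, hl⟩ := List.subperm_of_subset h hs
  rw [encodeFacts, encodeFacts, ← (hp.flatMap_right _).length_eq]
  exact (hl.flatMap _).length_le

theorem length_le_length_encodeFacts (L : List (Fact S V)) :
    L.length ≤ (encodeFacts e L).length := by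
  induction L with
  | nil => simp
  | cons t L ih =>
    have := List.length_pos_iff.2 (encodeFact_ne_nil e t)
    simp only [encodeFacts, List.flatMap_cons, List.length_append, List.length_cons] at ih ⊢
    omega

/-- The string that a term denotes if the strings `f` are assigned to the variables. -/
def Term.block (f : ℕ → List A) : Term V → List A
  | .var x => f x
  | .const c => e.encode c

/-- The string that an atom denotes if the strings `f` are assigned to the variables. -/
def Atom.string (f : ℕ → List A) (a : Atom S V) : List (Letter S A) :=
  writeFact a.rel ((List.ofFn a.args).map (Term.block e f))

theorem Atom.string_ne_nil (f : ℕ → List A) (a : Atom S V) : a.string e f ≠ [] := by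
  simp [Atom.string, writeFact]

theorem Atom.string_infix_iff (f : ℕ → List A) (a : Atom S V) (L : List (Fact S V)) :
    a.string e f <:+: encodeFacts e L ↔ ∃ t ∈ L, encodeFact e t = a.string e f :=
  writeFact_infix_iff e (by simp) L

theorem Atom.encodeFact_eval {f : ℕ → List A} {α : ℕ → V} {a : Atom S V}
    (h : ∀ j, Term.block e f (a.args j) = e.encode ((a.args j).eval α)) :
    encodeFact e (a.eval α) = a.string e f := by
  rw [encodeFact_eq, Atom.string]
  refine congrArg (writeFact a.rel) ?_
  rw [List.map_ofFn, List.map_ofFn]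
  exact congrArg _ (funext fun j => (h j).symm)

/-- The tuples `L₁` and delta tuples `L₂`, as a state of the evaluation. For stage semantics, the
delta tuples are removed from the relations. -/
def listState (stage : Bool) (L₁ L₂ : List (Fact S V)) : State S V :=
  ⟨{t | t ∈ L₁ ∧ (stage = true → t ∉ L₂)}, {t | t ∈ L₂}⟩

/-- The strings `f` make the body atom true. -/
def BodyAtom.StringHolds (stage : Bool) (L₁ L₂ : List (Fact S V)) (f : ℕ → List A) :
    BodyAtom S V → Prop
  | .base a => a.string e f <:+: encodeFacts e L₁ ∧
      (stage = true → ¬ a.string e f <:+: encodeFacts e L₂)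
  | .delta a => a.string e f <:+: encodeFacts e L₂

/-- The atom in a body atom. -/
def BodyAtom.atom : BodyAtom S V → Atom S V
  | .base a => a
  | .delta a => a

theorem BodyAtom.stringHolds_iff {stage : Bool} {L₁ L₂ : List (Fact S V)} {f : ℕ → List A}
    {α : ℕ → V} {q : BodyAtom S V} (h : encodeFact e (q.atom.eval α) = q.atom.string e f) :
    q.StringHolds e stage L₁ L₂ f ↔ q.Holds (listState stage L₁ L₂) α := by
  have key : ∀ L, q.atom.string e f <:+: encodeFacts e L ↔ q.atom.eval α ∈ L := fun L => by
    rw [Atom.string_infix_iff, ← h]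
    exact ⟨fun ⟨t, ht, ht'⟩ => encodeFact_injective e ht' ▸ ht, fun h => ⟨_, h, rfl⟩⟩
  cases q with
  | base a => exact and_congr (key L₁) (imp_congr_right fun _ => not_congr (key L₂))
  | delta a => exact key L₂

theorem BodyAtom.StringHolds.exists_encodeFact {stage : Bool} {L₁ L₂ : List (Fact S V)}
    {f : ℕ → List A} {q : BodyAtom S V} (h : q.StringHolds e stage L₁ L₂ f) :
    ∃ t, encodeFact e t = q.atom.string e f := by
  cases q with
  | base a =>
    obtain ⟨t, -, ht⟩ := (a.string_infix_iff e f L₁).1 h.1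
    exact ⟨t, ht⟩
  | delta a =>
    obtain ⟨t, -, ht⟩ := (a.string_infix_iff e f L₂).1 h
    exact ⟨t, ht⟩

theorem Atom.encode_mem_of_encodeFact_eq {f : ℕ → List A} {a : Atom S V} {t : Fact S V}
    (h : encodeFact e t = a.string e f) (j : Fin (S.arity a.rel)) :
    ∃ v, e.encode v = Term.block e f (a.args j) := by
  rw [encodeFact_eq, Atom.string, writeFact, writeFact, List.cons.injEq, Letter.rel.injEq] at h
  have h₃ : (List.ofFn t.val).map e.encode = (List.ofFn a.args).map (Term.block e f) :=
    writeBlocks_prefix (l := []) (by simp [h.1]) (by rw [List.append_nil, h.2])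
  have hj : Term.block e f (a.args j) ∈ (List.ofFn a.args).map (Term.block e f) :=
    List.mem_map_of_mem ((List.mem_ofFn' a.args _).2 ⟨j, rfl⟩)
  rw [← h₃, List.mem_map] at hj
  obtain ⟨v, -, hv⟩ := hj
  exact ⟨v, hv⟩

-- Strings cut out of the input need not encode values. A variable whose string does not is given an
-- arbitrary value; it occurs in no atom whose string encodes a tuple.
open Classical in
theorem exists_assignment [Nonempty V] (f : ℕ → List A) :
    ∃ α : ℕ → V, ∀ a : Atom S V, ∀ t, encodeFact e t = a.string e f →
      encodeFact e (a.eval α) = a.string e f := by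
  refine ⟨fun x => if h : ∃ v, e.encode v = f x then h.choose else Classical.arbitrary V,
    fun a t ht => Atom.encodeFact_eval e fun j => ?_⟩
  have hj := a.encode_mem_of_encodeFact_eq e ht j
  cases h : a.args j with
  | var x =>
    rw [h, Term.block] at hj
    rw [Term.block, Term.eval, dif_pos hj]
    exact hj.choose_spec.symm
  | const c => rfl

/-- The variable `x` is named below `m`. -/
def Term.Below (m : ℕ) : Term V → Prop
  | .var x => x < m
  | .const _ => True

/-- The strings that are assigned to the variables if the values of finitely many variables begin
the strings `g`. -/
def blocks {m : ℕ} (g : Fin (m + 1) → List (Letter S A)) (x : ℕ) : List A :=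
  DeltaRules.block (g (Fin.ofNat (m + 1) x))

/-- A satisfied body maps all its atoms into `L₁`, so the value of each of its variables begins a
suffix of the string of `L₁`. Conversely, a matched body forces the strings of its variables to
encode values. The head needs no separate treatment, being a body atom. -/
theorem mem_derived_iff [Nonempty V] {stage : Bool} {L₁ L₂ : List (Fact S V)} (hL : L₂ ⊆ L₁)
    {P : DeltaProgram S V} {m : ℕ}
    (hm : ∀ r ∈ P, ∀ q ∈ r.body, ∀ j, (q.atom.args j).Below (m + 1)) (t : Fact S V) :
    t ∈ derived P (listState stage L₁ L₂) ↔ ∃ r ∈ P, ∃ g : Fin (m + 1) → List (Letter S A),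
      (∀ y, g y ≠ [] ∧ g y <:+ encodeFacts e L₁) ∧
      (∀ q ∈ r.body, q.StringHolds e stage L₁ L₂ (blocks g)) ∧
      encodeFact e t = r.head.string e (blocks g) := by
  constructor
  · rintro ⟨r, hr, α, hα, rfl⟩
    have hmem : ∀ q ∈ r.body, q.atom.eval α ∈ L₁ := fun q hq => by
      have := hα q hq
      cases q with
      | base a => exact this.1
      | delta a => exact hL this
    -- The whole string serves variables that are absent from the body. It is nonempty because the
    -- head atom is mapped into `L₁`.
    have hne : encodeFacts e L₁ ≠ [] := fun h => by
      have := length_le_length_encodeFacts e L₁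
      rw [h, List.length_nil, Nat.le_zero, List.length_eq_zero_iff] at this
      exact List.not_mem_nil (this ▸ hmem (.base r.head) List.mem_cons_self)
    have hex : ∀ x, ∃ s : List (Letter S A), (s ≠ [] ∧ s <:+ encodeFacts e L₁) ∧
        ∀ q ∈ r.body, ∀ j, q.atom.args j = .var x → block s = e.encode (α x) := fun x => by
      by_cases h : ∃ q ∈ r.body, ∃ j, q.atom.args j = .var x
      · obtain ⟨q, hq, j, hj⟩ := h
        obtain ⟨s, h₁, h₂, h₃⟩ := exists_suffix_block e (hmem q hq) j
        exact ⟨s, ⟨h₁, h₂⟩, fun _ _ _ _ => by simpa [Atom.eval, hj, Term.eval] using h₃⟩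
      · exact ⟨_, ⟨hne, List.suffix_rfl⟩, fun q hq j hj => absurd ⟨q, hq, j, hj⟩ h⟩
    choose g hg hg' using hex
    have heq : ∀ q ∈ r.body, encodeFact e (q.atom.eval α) = q.atom.string e (blocks (m := m) fun y => g y) :=
      fun q hq => Atom.encodeFact_eval e fun j => by
        cases h : q.atom.args j with
        | var x =>
          have hx : x < m + 1 := by simpa [h, Term.Below] using hm r hr q hq j
          rw [Term.block, blocks, Fin.val_ofNat, Nat.mod_eq_of_lt hx]
          exact hg' x q hq j h
        | const c => rfl
    exact ⟨r, hr, fun y => g y, fun y => hg y,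
      fun q hq => (q.stringHolds_iff e (heq q hq)).2 (hα q hq), heq (.base r.head) List.mem_cons_self⟩
  · rintro ⟨r, hr, g, -, hb, ht⟩
    obtain ⟨α, hα⟩ := exists_assignment (S := S) e (blocks g)
    have heq : ∀ q ∈ r.body, encodeFact e (q.atom.eval α) = q.atom.string e (blocks (m := m) fun y => g y) :=
      fun q hq => by
        obtain ⟨t', ht'⟩ := (hb q hq).exists_encodeFact
        exact hα _ _ ht'
    refine ⟨r, hr, α, fun q hq => (q.stringHolds_iff e (heq q hq)).1 (hb q hq), ?_⟩
    exact encodeFact_injective e (ht.trans (heq (.base r.head) List.mem_cons_self).symm)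

end Strings

end DeltaRules

/-! ### Program fragments for atoms, variables and tests -/

namespace DeltaRules

open StackProgram Function

variable {S : Schema} {V A : Type} {m : ℕ}

instance : Inhabited (Letter S A) := ⟨.sep⟩

/-- The data on which the program works: the tuples of the database, the delta tuples of the present
and of the next state, the strings from which the values of the variables are read, and the counter
of rounds. -/
structure Memory (S : Schema) (V A : Type) (m : ℕ) where
  base : List (Fact S V)
  del : List (Fact S V)
  new : List (Fact S V)
  val : Fin (m + 1) → List (Letter S A)
  cnt : List (Letter S A)

/-- The same data with another list of delta tuples of the next state. -/
def Memory.withNew (x : Memory S V A m) (N : List (Fact S V)) : Memory S V A m :=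
  { x with new := N }

/-- The same data with another string for the variable `y`. -/
def Memory.withVal (x : Memory S V A m) (y : Fin (m + 1)) (s : List (Letter S A)) :
    Memory S V A m :=
  { x with val := update x.val y s }

variable (e : Computability.Encoding V A)

/-- The stacks of the program, between two tests. -/
def Memory.stacks (x : Memory S V A m) : Reg (m + 1) → List (Letter S A)
  | .inp => encodeFacts e x.base
  | .del => encodeFacts e x.del
  | .new => encodeFacts e x.new
  | .cnt => x.cnt
  | .val y => x.val y
  | _ => []

/-- The length of the input. -/
def Memory.size (x : Memory S V A m) : ℕ := (encodeFacts e x.base).length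

/-- The invariant of the program. -/
structure Memory.Valid (x : Memory S V A m) : Prop where
  nodup_base : x.base.Nodup
  nodup_del : x.del.Nodup
  nodup_new : x.new.Nodup
  del_subset : x.del ⊆ x.base
  new_subset : x.new ⊆ x.base
  length_val : ∀ y, (x.val y).length ≤ x.size e

/-- A stack that holds a list of tuples. -/
def IsFactStack (X : Reg (m + 1)) : Prop := X = .inp ∨ X = .del ∨ X = .new

variable {e} in
theorem Memory.Valid.length_stacks_le {x : Memory S V A m} (h : x.Valid e) {X : Reg (m + 1)}
    (hX : IsFactStack X) : (x.stacks e X).length ≤ x.size e := by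
  rcases hX with rfl | rfl | rfl
  · exact le_rfl
  · exact length_encodeFacts_le e h.nodup_del h.del_subset
  · exact length_encodeFacts_le e h.nodup_new h.new_subset

/-- Push a string. -/
def pushList (k : Reg (m + 1)) : List (Letter S A) → Cmd (Reg (m + 1)) (Letter S A)
  | [] => Cmd.skip
  | a :: l => (pushList k l).seq (Cmd.push k a)

theorem runs_pushList (k : Reg (m + 1)) (l : List (Letter S A)) (T : Reg (m + 1) → List (Letter S A)) :
    Runs (pushList k l) T (update T k (l ++ T k)) (l.length + 1) := by
  induction l with
  | nil => exact (runs_skip T).congr (by simp) le_rfl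
  | cons a l ih => exact (ih.seq (runs_push k a _)).congr (by simp) le_rfl

/-- Write the string of a term, with a separator behind it, on `w`. -/
def pushTerm : Term V → Cmd (Reg (m + 1)) (Letter S A)
  | .var x => (Cmd.push .w .sep).seq
      (Cmd.copyWhile .tmp Letter.isChar (.val (Fin.ofNat (m + 1) x)) .w)
  | .const c => (Cmd.push .w .sep).seq (pushList .w ((e.encode c).map Letter.char))

/-- Write the strings of terms on `w`. -/
def pushTerms : List (Term V) → Cmd (Reg (m + 1)) (Letter S A)
  | [] => Cmd.skip
  | t :: ts => (pushTerms ts).seq (pushTerm e t)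

/-- Write the string of an atom on `w`. -/
def pushAtom (a : Atom S V) : Cmd (Reg (m + 1)) (Letter S A) :=
  (pushTerms e (List.ofFn a.args)).seq (Cmd.push .w (.rel a.rel))

theorem length_block_le (s : List (Letter S A)) : (block s).length ≤ s.length := by
  have h := (List.takeWhile_prefix Letter.isChar (l := s)).length_le
  rwa [takeWhile_isChar, List.length_map] at h

/-- A stack is written from the end, so the separator is pushed first. The code of a constant has a
fixed length, which enters the polynomial as a coefficient. -/
theorem runs_pushTerm (t : Term V) : ∃ p : Polynomial ℕ, ∀ x : Memory S V A m, x.Valid e → ∀ w,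
    (writeBlocks S [t.block e (blocks x.val)]).length ≤ p.eval (x.size e) ∧
    Runs (pushTerm e t) (update (x.stacks e) .w w)
      (update (x.stacks e) .w (writeBlocks S [t.block e (blocks x.val)] ++ w))
      (p.eval (x.size e)) := by
  cases t with
  | var y =>
    refine ⟨4 * Polynomial.X + 3, fun x hx w => ?_⟩
    have hl := hx.length_val (Fin.ofNat (m + 1) y)
    constructor
    · have := length_block_le (x.val (Fin.ofNat (m + 1) y))
      simp [writeBlocks, Term.block, blocks] at this hl ⊢
      omega
    · have h₁ := runs_push Reg.w (Letter.sep : Letter S A) (update (x.stacks e) .w w)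
      have h₂ := runs_copyWhile (tmp := Reg.tmp) (i := .val (Fin.ofNat (m + 1) y)) (j := .w)
        (by simp) (by simp) (by simp) Letter.isChar
        (S := update (update (x.stacks e) .w w) .w (.sep :: (update (x.stacks e) .w w) .w))
        (by simp [Memory.stacks])
      refine (h₁.seq h₂).congr ?_ ?_
      · simp [Memory.stacks, writeBlocks, Term.block, blocks, takeWhile_isChar]
      · simp [Memory.stacks] at hl ⊢
        omega
  | const c =>
    refine ⟨(((e.encode c).length + 2 : ℕ) : Polynomial ℕ), fun x hx w => ?_⟩
    constructor
    · simp [writeBlocks, Term.block]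
    · have h₁ := runs_push Reg.w (Letter.sep : Letter S A) (update (x.stacks e) .w w)
      refine (h₁.seq (runs_pushList _ _ _)).congr ?_ ?_
      · simp [writeBlocks, Term.block]
      · simp only [List.length_map, Polynomial.eval_natCast, Nat.cast_id]
        omega

theorem runs_pushTerms (ts : List (Term V)) : ∃ p : Polynomial ℕ, ∀ x : Memory S V A m,
    x.Valid e → ∀ w,
    (writeBlocks S (ts.map (Term.block e (blocks x.val)))).length ≤ p.eval (x.size e) ∧
    Runs (pushTerms e ts) (update (x.stacks e) .w w)
      (update (x.stacks e) .w (writeBlocks S (ts.map (Term.block e (blocks x.val))) ++ w))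
      (p.eval (x.size e)) := by
  induction ts with
  | nil =>
    refine ⟨1, fun x hx w => ⟨by simp [writeBlocks], ?_⟩⟩
    exact (runs_skip _).congr (by simp [writeBlocks]) (by simp)
  | cons t ts ih =>
    obtain ⟨p, hp⟩ := ih
    obtain ⟨q, hq⟩ := runs_pushTerm (S := S) (m := m) e t
    refine ⟨p + q, fun x hx w => ?_⟩
    obtain ⟨h₁, h₂⟩ := hp x hx w
    obtain ⟨h₃, h₄⟩ := hq x hx (writeBlocks S (ts.map (Term.block e (blocks x.val))) ++ w)
    have hw : writeBlocks S ((t :: ts).map (Term.block e (blocks x.val))) =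
        writeBlocks S [t.block e (blocks x.val)] ++
          writeBlocks S (ts.map (Term.block e (blocks x.val))) := by
      simp [writeBlocks]
    rw [hw, List.length_append, Polynomial.eval_add, List.append_assoc]
    exact ⟨by omega, h₂.seq h₄⟩

theorem runs_pushAtom (a : Atom S V) : ∃ p : Polynomial ℕ, ∀ x : Memory S V A m, x.Valid e →
    (a.string e (blocks x.val)).length ≤ p.eval (x.size e) ∧
    Runs (pushAtom e a) (x.stacks e) (update (x.stacks e) .w (a.string e (blocks x.val)))
      (p.eval (x.size e)) := by
  obtain ⟨p, hp⟩ := runs_pushTerms (S := S) (m := m) e (List.ofFn a.args)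
  refine ⟨p + 1, fun x hx => ?_⟩
  obtain ⟨h₁, h₂⟩ := hp x hx []
  rw [show update (x.stacks e) .w [] = x.stacks e from update_eq_self Reg.w (x.stacks e)] at h₂
  rw [Polynomial.eval_add, Polynomial.eval_one]
  constructor
  · rw [Atom.string, writeFact, List.length_cons]
    omega
  · exact (h₂.seq (runs_push _ _ _)).congr (by simp [Atom.string, writeFact]) le_rfl

/-- The fragment `c` adds the tuples that satisfy `Q` to the delta tuples of the next state, in
polynomial time, if it is started in a state that satisfies `Pre`. -/
def Adds (Pre : Memory S V A m → Prop) (c : Cmd (Reg (m + 1)) (Letter S A))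
    (Q : Memory S V A m → Fact S V → Prop) : Prop :=
  ∃ p : Polynomial ℕ, ∀ x : Memory S V A m, x.Valid e → Pre x →
    ∃ N, (x.withNew N).Valid e ∧ (∀ t, t ∈ N ↔ t ∈ x.new ∨ Q x t) ∧
      Runs c (x.stacks e) ((x.withNew N).stacks e) (p.eval (x.size e))

variable {e}

/-- Agreement is required only up to tuples already in `new`; this absorbs the guard against
repetitions in `adds_deriveIf`. -/
theorem Adds.congr {Pre Pre' : Memory S V A m → Prop} {c : Cmd (Reg (m + 1)) (Letter S A)}
    {Q Q' : Memory S V A m → Fact S V → Prop} (h : Adds e Pre c Q) (hPre : ∀ x, Pre' x → Pre x)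
    (hQ : ∀ x t, Pre' x → (t ∈ x.new ∨ Q x t ↔ t ∈ x.new ∨ Q' x t)) : Adds e Pre' c Q' := by
  obtain ⟨p, hp⟩ := h
  refine ⟨p, fun x hx hx' => ?_⟩
  obtain ⟨N, h₁, h₂, h₃⟩ := hp x hx (hPre x hx')
  exact ⟨N, h₁, fun t => (h₂ t).trans (hQ x t hx'), h₃⟩

theorem adds_skip : Adds e (fun _ : Memory S V A m => True) Cmd.skip (fun _ _ => False) :=
  ⟨1, fun x hx _ => ⟨x.new, hx, fun t => by simp, (runs_skip _).mono (by simp)⟩⟩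

theorem Adds.seq {Pre Pre' : Memory S V A m → Prop} {c d : Cmd (Reg (m + 1)) (Letter S A)}
    {Q Q' : Memory S V A m → Fact S V → Prop} (h : Adds e Pre c Q) (h' : Adds e Pre' d Q')
    (hPre : ∀ x N, Pre x → Pre' (x.withNew N)) (hQ : ∀ x N t, Q' (x.withNew N) t ↔ Q' x t) :
    Adds e Pre (c.seq d) (fun x t => Q x t ∨ Q' x t) := by
  obtain ⟨p, hp⟩ := h
  obtain ⟨q, hq⟩ := h'
  refine ⟨p + q, fun x hx hx' => ?_⟩
  obtain ⟨N, h₁, h₂, h₃⟩ := hp x hx hx'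
  obtain ⟨N', h₁', h₂', h₃'⟩ := hq _ h₁ (hPre x N hx')
  refine ⟨N', h₁', fun t => ?_, ?_⟩
  · rw [h₂', hQ, show (x.withNew N).new = N from rfl, h₂, or_assoc]
  · rw [Polynomial.eval_add]
    exact h₃.seq h₃'

/-- Run `c` for all values of the variable `y`. -/
def loopVar (y : Fin (m + 1)) (c : Cmd (Reg (m + 1)) (Letter S A)) :
    Cmd (Reg (m + 1)) (Letter S A) :=
  (Cmd.copyWhile .tmp (fun _ => true) .inp (.val y)).seq
    (Cmd.whileTop (.val y) (fun _ => true) (c.seq (Cmd.pop (.val y))))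

theorem stacks_withVal (x : Memory S V A m) (y : Fin (m + 1)) (s : List (Letter S A)) :
    (x.withVal y s).stacks e = update (x.stacks e) (.val y) s := by
  funext k
  cases k with
  | val z =>
    by_cases h : z = y
    · subst h
      simp [Memory.stacks, Memory.withVal]
    · simp [Memory.stacks, Memory.withVal, h]
  | _ => simp [Memory.stacks, Memory.withVal]

theorem Memory.Valid.withVal {x : Memory S V A m} (h : x.Valid e) {y : Fin (m + 1)}
    {s : List (Letter S A)} (hs : s.length ≤ x.size e) : (x.withVal y s).Valid e where
  nodup_base := h.nodup_base
  nodup_del := h.nodup_del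
  nodup_new := h.nodup_new
  del_subset := h.del_subset
  new_subset := h.new_subset
  length_val z := by
    by_cases hz : z = y
    · subst hz
      simpa [Memory.withVal, Memory.size] using hs
    · simpa [Memory.withVal, Memory.size, hz] using h.length_val z

/-- Popping a copy of the input letter by letter visits its nonempty suffixes. The stack of `y` is
empty before and after, so loops can be nested; each multiplies the time by about the input length.
-/
theorem Adds.loopVar {Pre : Memory S V A m → Prop} {c : Cmd (Reg (m + 1)) (Letter S A)}
    {Q : Memory S V A m → Fact S V → Prop} (h : Adds e Pre c Q)
    (hPre : ∀ x N, Pre x → Pre (x.withNew N)) (hQ : ∀ x N t, Q (x.withNew N) t ↔ Q x t)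
    (y : Fin (m + 1)) :
    Adds e (fun x => x.val y = [] ∧ ∀ s, Pre (x.withVal y s)) (loopVar y c)
      (fun x t => ∃ s, (s ≠ [] ∧ s <:+ encodeFacts e x.base) ∧ Q (x.withVal y s) t) := by
  obtain ⟨p, hp⟩ := h
  -- Here `s` is what is left on the stack of `y`; `x` must vary because each pass may enlarge
  -- `new`.
  have key : ∀ (s : List (Letter S A)) (x : Memory S V A m), x.Valid e →
      (∀ s, Pre (x.withVal y s)) → s.length ≤ x.size e →
      ∃ N, (x.withNew N).Valid e ∧
        (∀ t, t ∈ N ↔ t ∈ x.new ∨ ∃ s', (s' ≠ [] ∧ s' <:+ s) ∧ Q (x.withVal y s') t) ∧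
        Runs (Cmd.whileTop (.val y) (fun _ => true) (c.seq (Cmd.pop (.val y))))
          ((x.withVal y s).stacks e) (((x.withNew N).withVal y []).stacks e)
          (s.length * (p.eval (x.size e) + 2) + 1) := by
    intro s
    induction s with
    | nil =>
      intro x hx _ _
      exact ⟨x.new, hx, by simp, (runs_whileTop_of_not _ (by simp [stacks_withVal])).mono (by simp)⟩
    | cons a s ih =>
      intro x hx hx' hs
      obtain ⟨N, h₁, h₂, h₃⟩ := hp _ (hx.withVal hs) (hx' (a :: s))
      have hN : (x.withNew N).Valid e := by
        have := h₁.withVal (hx.length_val y) (y := y)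
        convert this using 1
        simp [Memory.withNew, Memory.withVal]
      obtain ⟨N', h₁', h₂', h₃'⟩ := ih (x.withNew N) hN (fun s => hPre _ _ (hx' s))
        (by simp only [List.length_cons] at hs; exact (Nat.le_succ _).trans hs)
      refine ⟨N', h₁', fun t => ?_, ?_⟩
      · have e₁ : ∀ s', Q ((x.withNew N).withVal y s') t ↔ Q (x.withVal y s') t :=
          fun s' => hQ (x.withVal y s') N t
        simp only [h₂', e₁]
        rw [show (x.withNew N).new = N from rfl, h₂, show (x.withVal y (a :: s)).new = x.new from rfl,
          or_assoc]
        refine or_congr_right ⟨?_, ?_⟩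
        · rintro (h | ⟨s', ⟨h, h'⟩, h''⟩)
          · exact ⟨a :: s, ⟨by simp, List.suffix_rfl⟩, h⟩
          · exact ⟨s', ⟨h, h'.trans (List.suffix_cons a s)⟩, h''⟩
        · rintro ⟨s', ⟨h, h'⟩, h''⟩
          rcases List.suffix_cons_iff.1 h' with rfl | h'
          · exact .inl h''
          · exact .inr ⟨s', ⟨h, h'⟩, h''⟩
      · have h₄ := runs_pop (Reg.val y) (((x.withVal y (a :: s)).withNew N).stacks e)
        have e₂ : update (((x.withVal y (a :: s)).withNew N).stacks e) (.val y)
            (((x.withVal y (a :: s)).withNew N).stacks e (.val y)).tail =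
              ((x.withNew N).withVal y s).stacks e := by
          rw [stacks_withVal, show (x.withVal y (a :: s)).withNew N =
            (x.withNew N).withVal y (a :: s) from rfl, stacks_withVal]
          simp
        rw [e₂] at h₄
        refine (Runs.whileTop (by simp [stacks_withVal]) (h₃.seq h₄) h₃').mono ?_
        rw [List.length_cons, add_mul, show (x.withVal y (a :: s)).size e = x.size e from rfl,
          show (x.withNew N).size e = x.size e from rfl]
        omega
  refine ⟨4 * Polynomial.X + 2 + (Polynomial.X * (p + 2) + 1), fun x hx hx' => ?_⟩
  obtain ⟨N, h₁, h₂, h₃⟩ := key (encodeFacts e x.base) x hx hx'.2 le_rfl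
  refine ⟨N, h₁, h₂, ?_⟩
  have h₀ := runs_copyWhile (tmp := Reg.tmp) (i := .inp) (j := .val y) (by simp) (by simp) (by simp)
    (fun _ => true) (S := x.stacks e) rfl
  rw [takeWhile_const_true, show x.stacks e (.val y) = [] from hx'.1, List.append_nil,
    show x.stacks e .inp = encodeFacts e x.base from rfl, ← stacks_withVal] at h₀
  refine (h₀.seq h₃).congr ?_ ?_
  · rw [stacks_withVal]
    refine (update_eq_self_iff.2 ?_).symm
    exact hx'.1.symm
  · simp [Memory.size]

/-- Run `c` if the string of the atom `a` is (or is not, as prescribed by `b`) a part of `X`. -/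
noncomputable def ifInfix (e : Computability.Encoding V A) (b : Bool) (X : Reg (m + 1))
    (a : Atom S V) (c : Cmd (Reg (m + 1)) (Letter S A)) : Cmd (Reg (m + 1)) (Letter S A) :=
  (pushAtom e a).seq <| (testInfix X).seq <| (Cmd.clear .w).seq <|
    Cmd.ifEmpty .hit (if b then Cmd.skip else c) ((Cmd.clear .hit).seq (if b then c else Cmd.skip))

/-- The outcome of the test becomes part of the precondition of `c`, so that inner fragments can
rely on it. -/
theorem Adds.ifInfix {Pre : Memory S V A m → Prop} {b : Bool} {X : Reg (m + 1)} {a : Atom S V}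
    {c : Cmd (Reg (m + 1)) (Letter S A)} {Q : Memory S V A m → Fact S V → Prop}
    (hX : IsFactStack X)
    (h : Adds e (fun x => Pre x ∧ (a.string e (blocks x.val) <:+: x.stacks e X ↔ b = true)) c Q) :
    Adds e Pre (ifInfix e b X a c) (fun x t =>
      (a.string e (blocks x.val) <:+: x.stacks e X ↔ b = true) ∧ Q x t) := by
  obtain ⟨p, hp⟩ := h
  obtain ⟨q, hq⟩ := runs_pushAtom (m := m) e a
  refine ⟨q + ((Polynomial.X * (8 * q + 6 * Polynomial.X + 14) + 3) + ((2 * q + 1) +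
    (1 + ((2 * Polynomial.X + 1) + (p + 1))))), fun x hx hx' => ?_⟩
  obtain ⟨hl, h₁⟩ := hq x hx
  set W := a.string e (blocks x.val) with hW
  have hWne : W ≠ [] := a.string_ne_nil e _
  have hXne : X ≠ .tmp ∧ X ≠ .r ∧ X ≠ .w := by
    rcases hX with rfl | rfl | rfl <;> simp
  have hXl := hx.length_stacks_le hX
  obtain ⟨H, hH, hHl, h₂⟩ := runs_testInfix (S := update (x.stacks e) .w W) (X := X)
    (by simp [Memory.stacks]) (by simp [Memory.stacks]) (by simp [Memory.stacks])
    (by simp [Memory.stacks]) (by simp [Memory.stacks]) (by simp [Memory.stacks])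
    (by simpa using hWne) hXne.1 hXne.2.1
  rw [update_self, update_of_ne hXne.2.2] at hH h₂
  rw [update_of_ne hXne.2.2] at hHl
  have h₃ := runs_clear Reg.w (update (update (x.stacks e) .w W) .hit H)
  have e₃ : update (update (update (x.stacks e) .w W) .hit H) .w [] =
      update (x.stacks e) .hit H := by
    funext k
    cases k <;> simp [Memory.stacks]
  rw [e₃, show update (update (x.stacks e) .w W) .hit H .w = W by simp] at h₃
  have h₄ : Runs (Cmd.clear .hit) (update (x.stacks e) .hit H) (x.stacks e)
      (2 * x.size e + 1) := by
    refine (runs_clear Reg.hit _).congr ?_ (by rw [update_self]; omega)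
    funext k
    cases k <;> simp [Memory.stacks]
  have hT : (x.stacks e X).length * (8 * W.length + 6 * (x.stacks e X).length + 14) + 3 ≤
      x.size e * (8 * q.eval (x.size e) + 6 * x.size e + 14) + 3 := by gcongr
  -- All cases share the part up to the branch; only the branch remains to be run, within a common
  -- bound.
  have hfin : ∀ {T' : Reg (m + 1) → List (Letter S A)},
      Runs (Cmd.ifEmpty .hit (if b then Cmd.skip else c)
        ((Cmd.clear .hit).seq (if b then c else Cmd.skip))) (update (x.stacks e) .hit H) T'
        (1 + ((2 * x.size e + 1) + (p.eval (x.size e) + 1))) →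
      Runs (DeltaRules.ifInfix e b X a c) (x.stacks e) T' ((q + ((Polynomial.X * (8 * q +
        6 * Polynomial.X + 14) + 3) + ((2 * q + 1) + (1 + ((2 * Polynomial.X + 1) +
        (p + 1)))))).eval (x.size e)) := fun hr => by
    refine (h₁.seq (h₂.seq (h₃.seq hr))).mono ?_
    simp only [Polynomial.eval_add, Polynomial.eval_mul, Polynomial.eval_X, Polynomial.eval_one,
      Polynomial.eval_ofNat]
    omega
  by_cases hc : W <:+: x.stacks e X ↔ b = true
  · obtain ⟨N, hN, hN', h₅⟩ := hp x hx ⟨hx', hc⟩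
    refine ⟨N, hN, fun t => (hN' t).trans (by simp [← hW, hc]), hfin ?_⟩
    cases b with
    | true =>
      have : H ≠ [] := hH.2 (hc.2 rfl)
      exact Runs.ifEmpty_of_ne _ (by simpa using this) (h₄.seq (h₅.mono (by omega)))
    | false =>
      have : H = [] := by
        by_contra h
        simpa using hc.1 (hH.1 h)
      subst this
      rw [show update (x.stacks e) .hit [] = x.stacks e from update_eq_self Reg.hit (x.stacks e)]
      exact Runs.ifEmpty_of_eq _ rfl (h₅.mono (by omega))
  · refine ⟨x.new, hx, fun t => by simp [← hW, hc], hfin ?_⟩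
    cases b with
    | true =>
      have : H = [] := by
        by_contra h
        exact hc (iff_of_true (hH.1 h) rfl)
      subst this
      rw [show update (x.stacks e) .hit [] = x.stacks e from update_eq_self Reg.hit (x.stacks e)]
      exact Runs.ifEmpty_of_eq _ rfl ((runs_skip _).mono (by omega))
    | false =>
      have : H ≠ [] := fun h => hc (iff_of_false (fun h' => hH.2 h' h) (by simp))
      exact Runs.ifEmpty_of_ne _ (by simpa using this) (h₄.seq ((runs_skip _).mono (by omega)))

/-- Add the tuple denoted by the atom `a` to the delta tuples of the next state. -/
def emit (e : Computability.Encoding V A) (a : Atom S V) : Cmd (Reg (m + 1)) (Letter S A) :=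
  (pushAtom e a).seq <| (Cmd.copyWhile .tmp (fun _ => true) .w .new).seq (Cmd.clear .w)

/-- The two preconditions preserve the invariant: `new` stays inside the database and free of
repetitions. -/
theorem adds_emit (a : Atom S V) :
    Adds e (fun x : Memory S V A m => (∃ t ∈ x.base, encodeFact e t = a.string e (blocks x.val)) ∧
        (a.string e (blocks x.val) <:+: x.stacks e .new ↔ false = true))
      (emit e a) (fun x t => encodeFact e t = a.string e (blocks x.val)) := by
  obtain ⟨q, hq⟩ := runs_pushAtom (m := m) e a
  refine ⟨q + ((4 * q + 2) + (2 * q + 1)), fun x hx hx' => ?_⟩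
  obtain ⟨⟨t, ht, hta⟩, hn⟩ := hx'
  obtain ⟨hl, h₁⟩ := hq x hx
  set W := a.string e (blocks x.val) with hW
  have htn : t ∉ x.new := fun h => by
    have := (a.string_infix_iff e (blocks x.val) x.new).2 ⟨t, h, hta⟩
    simpa using hn.1 this
  have h₂ := runs_copyWhile (tmp := Reg.tmp) (i := .w) (j := .new) (by simp) (by simp) (by simp)
    (fun _ => true) (S := update (x.stacks e) .w W) (by simp [Memory.stacks])
  rw [takeWhile_const_true, update_self] at h₂
  have h₃ := runs_clear Reg.w (update (update (x.stacks e) .w W) .new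
    (W ++ update (x.stacks e) .w W .new))
  refine ⟨t :: x.new, ⟨hx.nodup_base, hx.nodup_del, List.nodup_cons.2 ⟨htn, hx.nodup_new⟩,
    hx.del_subset, List.cons_subset.2 ⟨ht, hx.new_subset⟩, hx.length_val⟩, fun t' => ?_, ?_⟩
  · rw [List.mem_cons, or_comm, ← (encodeFact_injective e).eq_iff (a := t'), hta]
  · refine (h₁.seq (h₂.seq h₃)).congr ?_ ?_
    · funext k
      cases k <;> simp [Memory.stacks, Memory.withNew, encodeFacts, ← hta]
    · simp
      omega

end DeltaRules

/-! ### Evaluating rules, and one round of the evaluation -/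

namespace DeltaRules

open StackProgram Function

section Rules

variable {S : Schema} {V A : Type} {m : ℕ} {e : Computability.Encoding V A}

/-- Run `c` if the strings assigned to the variables make the body atom `q` true. -/
noncomputable def ifHolds (e : Computability.Encoding V A) (stage : Bool) (q : BodyAtom S V)
    (c : Cmd (Reg (m + 1)) (Letter S A)) : Cmd (Reg (m + 1)) (Letter S A) :=
  match q with
  | .base a => ifInfix e true .inp a (if stage then ifInfix e false .del a c else c)
  | .delta a => ifInfix e true .del a c

/-- The strings assigned to the variables make the body atom `q` true. -/
def Memory.Holds (e : Computability.Encoding V A) (stage : Bool) (x : Memory S V A m)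
    (q : BodyAtom S V) : Prop :=
  q.StringHolds e stage x.base x.del (blocks x.val)

theorem Adds.ifHolds {stage : Bool} {q : BodyAtom S V} {Pre : Memory S V A m → Prop}
    {c : Cmd (Reg (m + 1)) (Letter S A)} {Q : Memory S V A m → Fact S V → Prop}
    (h : Adds e (fun x => Pre x ∧ x.Holds e stage q) c Q) :
    Adds e Pre (ifHolds e stage q c) (fun x t => x.Holds e stage q ∧ Q x t) := by
  cases q with
  | base a =>
    cases stage with
    | true =>
      refine (Adds.ifInfix (.inl rfl) (Adds.ifInfix (.inr (.inl rfl))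
        (h.congr (fun x hx => ?_) fun _ _ _ => Iff.rfl))).congr (fun _ hx => hx) fun x t _ => ?_
      · exact ⟨hx.1.1, hx.1.2.2 rfl, fun _ h => by simpa using hx.2.1 h⟩
      · simp [Memory.Holds, BodyAtom.StringHolds, Memory.stacks, and_assoc]
    | false =>
      refine (Adds.ifInfix (.inl rfl)
        (h.congr (fun x hx => ?_) fun _ _ _ => Iff.rfl)).congr (fun _ hx => hx) fun x t _ => ?_
      · exact ⟨hx.1, hx.2.2 rfl, fun h => by simp at h⟩
      · simp [Memory.Holds, BodyAtom.StringHolds, Memory.stacks]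
  | delta a =>
    refine (Adds.ifInfix (.inr (.inl rfl))
      (h.congr (fun x hx => ?_) fun _ _ _ => Iff.rfl)).congr (fun _ hx => hx) fun x t _ => ?_
    · exact ⟨hx.1, hx.2.2 rfl⟩
    · simp [Memory.Holds, BodyAtom.StringHolds, Memory.stacks]

/-- Add the tuple denoted by `a` to the delta tuples of the next state if the body atoms `qs` are
true. -/
noncomputable def deriveIf (e : Computability.Encoding V A) (stage : Bool)
    (qs : List (BodyAtom S V)) (a : Atom S V) : Cmd (Reg (m + 1)) (Letter S A) :=
  qs.foldr (ifHolds e stage) (ifInfix e false .new a (emit e a))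

theorem adds_deriveIf {stage : Bool} (qs : List (BodyAtom S V)) (a : Atom S V)
    {Pre : Memory S V A m → Prop} (h : ∀ x, Pre x → (∀ q ∈ qs, x.Holds e stage q) →
      ∃ t ∈ x.base, encodeFact e t = a.string e (blocks x.val)) :
    Adds e Pre (deriveIf e stage qs a) (fun x t => (∀ q ∈ qs, x.Holds e stage q) ∧
      encodeFact e t = a.string e (blocks x.val)) := by
  induction qs generalizing Pre with
  | nil =>
    refine (Adds.ifInfix (.inr (.inr rfl)) ((adds_emit a).congr
      (fun x (hx : Pre x ∧ _) => ⟨h x hx.1 (by simp), hx.2⟩) fun _ _ _ => Iff.rfl)).congr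
      (fun _ hx => hx) fun x t _ => ?_
    simp only [List.not_mem_nil, false_imp_iff, implies_true, true_and, Bool.false_eq_true,
      iff_false]
    constructor
    · rintro (h | h)
      · exact .inl h
      · exact .inr h.2
    · rintro (h | h)
      · exact .inl h
      -- The guard suppresses only a tuple that is already in `new`.
      · by_cases ht : t ∈ x.new
        · exact .inl ht
        · refine .inr ⟨fun h' => ?_, h⟩
          obtain ⟨t', ht', h''⟩ := (a.string_infix_iff e _ _).1 h'
          rw [← h] at h''
          exact ht (encodeFact_injective e h'' ▸ ht')
  | cons q qs ih =>
    refine (Adds.ifHolds (q := q) (stage := stage) (Pre := Pre) (ih fun x hx hq => ?_)).congr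
      (fun _ hx => hx) fun x t _ => ?_
    · exact h x hx.1 (List.forall_mem_cons.2 ⟨hx.2, hq⟩)
    · rw [List.forall_mem_cons, and_assoc]

/-- Run `c` for all values of the variables `ys`. -/
def loopVars (ys : List (Fin (m + 1))) (c : Cmd (Reg (m + 1)) (Letter S A)) :
    Cmd (Reg (m + 1)) (Letter S A) :=
  ys.foldr loopVar c

/-- Since `ys` has no repetitions, the inner loops leave the string chosen by an outer loop in
place. -/
theorem Adds.loopVars {c : Cmd (Reg (m + 1)) (Letter S A)} {Q : Memory S V A m → Fact S V → Prop}
    (h : Adds e (fun _ => True) c Q) (hQ : ∀ x N t, Q (x.withNew N) t ↔ Q x t)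
    {ys : List (Fin (m + 1))} (hys : ys.Nodup) :
    Adds e (fun x => ∀ y ∈ ys, x.val y = []) (loopVars ys c) (fun x t =>
      ∃ g, (∀ y ∈ ys, g y ≠ [] ∧ g y <:+ encodeFacts e x.base) ∧ (∀ y ∉ ys, g y = x.val y) ∧
        Q { x with val := g } t) := by
  induction ys with
  | nil =>
    refine h.congr (fun _ _ => trivial) fun x t _ => or_congr_right ?_
    refine ⟨fun h => ⟨x.val, by simp, fun _ _ => rfl, h⟩, fun ⟨g, _, hg, h⟩ => ?_⟩
    rwa [show g = x.val from funext fun y => hg y (by simp)] at h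
  | cons y ys ih =>
    rw [List.nodup_cons] at hys
    refine ((ih hys.2).loopVar (fun x N hx => hx)
      (fun x N t => exists_congr fun g => and_congr_right fun _ => and_congr_right fun _ =>
        hQ { x with val := g } N t) y).congr (fun x hx => ?_) fun x t _ => or_congr_right ?_
    · rw [List.forall_mem_cons] at hx
      refine ⟨hx.1, fun s z hz => ?_⟩
      exact (update_of_ne (fun h : z = y => hys.1 (h ▸ hz)) s x.val).trans (hx.2 z hz)
    · constructor
      · rintro ⟨s, hs, g, hg, hg', hgQ⟩
        have hy : g y = s := by simpa [Memory.withVal] using hg' y hys.1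
        refine ⟨g, List.forall_mem_cons.2 ⟨hy ▸ hs, hg⟩, fun z hz => ?_, hgQ⟩
        rw [List.mem_cons, not_or] at hz
        simpa [Memory.withVal, hz.1] using hg' z hz.2
      · rintro ⟨g, hg, hg', hgQ⟩
        rw [List.forall_mem_cons] at hg
        refine ⟨g y, hg.1, g, hg.2, fun z hz => ?_, hgQ⟩
        by_cases h : z = y
        · simp [Memory.withVal, h]
        · simpa [Memory.withVal, h] using hg' z (by simp [h, hz])

/-- Add all tuples derived by the rules to the delta tuples of the next state. -/
noncomputable def deriveAll (e : Computability.Encoding V A) (stage : Bool) (m : ℕ)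
    (rs : List (DeltaRule S V)) : Cmd (Reg (m + 1)) (Letter S A) :=
  rs.foldr (fun r c => (loopVars (List.finRange (m + 1)) (deriveIf e stage r.body r.head)).seq c)
    Cmd.skip

/-- The matching condition of the rules refers to `base` and `del`, and only `new` grows, so no rule
is affected by tuples derived in the same round. -/
theorem adds_deriveAll (stage : Bool) (rs : List (DeltaRule S V)) :
    Adds e (fun x : Memory S V A m => ∀ y, x.val y = []) (deriveAll e stage m rs) (fun x t =>
      ∃ r ∈ rs, ∃ g : Fin (m + 1) → List (Letter S A),
        (∀ y, g y ≠ [] ∧ g y <:+ encodeFacts e x.base) ∧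
        (∀ q ∈ r.body, q.StringHolds e stage x.base x.del (blocks g)) ∧
        encodeFact e t = r.head.string e (blocks g)) := by
  induction rs with
  | nil => exact adds_skip.congr (fun _ _ => trivial) fun x t _ => by simp
  | cons r rs ih =>
    have h₁ : Adds e (fun _ : Memory S V A m => True) (deriveIf e stage r.body r.head) _ :=
      adds_deriveIf r.body r.head fun x _ hq =>
        (r.head.string_infix_iff e _ _).1 (hq (.base r.head) List.mem_cons_self).1
    refine (Adds.seq (h₁.loopVars (fun x N t => Iff.rfl) (List.nodup_finRange (m + 1))) ih
      (fun x N hx y => hx y (List.mem_finRange y)) fun x N t => Iff.rfl).congr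
      (fun x hx y _ => hx y) fun x t _ => or_congr_right ?_
    rw [List.exists_mem_cons_iff]
    refine or_congr_left (exists_congr fun g => ?_)
    simp [Memory.Holds]

/-- The memory between two rounds. -/
def Memory.ofLists (m : ℕ) (L₁ L₂ : List (Fact S V)) (cnt : List (Letter S A)) :
    Memory S V A m :=
  ⟨L₁, L₂, [], fun _ => [], cnt⟩

/-- One step of the evaluation. -/
noncomputable def round (e : Computability.Encoding V A) (stage : Bool) (m : ℕ)
    (rs : List (DeltaRule S V)) : Cmd (Reg (m + 1)) (Letter S A) :=
  (Cmd.copyWhile .tmp (fun _ => true) .del .new).seq <| (deriveAll e stage m rs).seq <|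
    (Cmd.clear .del).seq <| (Cmd.copyWhile .tmp (fun _ => true) .new .del).seq (Cmd.clear .new)

/-- Starting `new` as a copy of `del` yields the union `Δ^t ∪ P[D^t]` without repetitions. The
polynomial is independent of `L₂`, since its string is no longer than that of `L₁`. -/
theorem runs_round [Nonempty V] (e : Computability.Encoding V A) (stage : Bool)
    {P : DeltaProgram S V} (hm : ∀ r ∈ P, ∀ q ∈ r.body, ∀ j, (q.atom.args j).Below (m + 1)) :
    ∃ p : Polynomial ℕ, ∀ L₁ L₂ : List (Fact S V), ∀ cnt : List (Letter S A), L₁.Nodup → L₂.Nodup →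
      L₂ ⊆ L₁ → ∃ L₃ : List (Fact S V), L₃.Nodup ∧ L₃ ⊆ L₁ ∧
        (∀ t, t ∈ L₃ ↔ t ∈ L₂ ∨ t ∈ derived P (listState stage L₁ L₂)) ∧
        Runs (round e stage m P.toList) ((Memory.ofLists m L₁ L₂ cnt).stacks e)
          ((Memory.ofLists m L₁ L₃ cnt).stacks e) (p.eval (encodeFacts e L₁).length) := by
  obtain ⟨p, hp⟩ := adds_deriveAll (m := m) (e := e) stage P.toList
  refine ⟨4 * Polynomial.X + 2 + (p + ((2 * Polynomial.X + 1) + ((4 * Polynomial.X + 2) +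
    (2 * Polynomial.X + 1)))), fun L₁ L₂ cnt h₁ h₂ h => ?_⟩
  let x : Memory S V A m := ⟨L₁, L₂, L₂, fun _ => [], cnt⟩
  have hx : x.Valid e := ⟨h₁, h₂, h₂, h, h, fun _ => Nat.zero_le _⟩
  obtain ⟨L₃, hv, hL₃, hr⟩ := hp x hx fun _ => rfl
  refine ⟨L₃, hv.nodup_new, hv.new_subset, fun t => ?_, ?_⟩
  · rw [hL₃, mem_derived_iff e h hm]
    simp [x]
  · have hl₂ := length_encodeFacts_le e h₂ h
    have hl₃ := length_encodeFacts_le e hv.nodup_new hv.new_subset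
    have r₁ := runs_copyWhile (tmp := Reg.tmp) (i := .del) (j := .new) (by simp) (by simp) (by simp)
      (fun _ => true) (S := (Memory.ofLists m L₁ L₂ cnt).stacks e) rfl
    have e₁ : update ((Memory.ofLists m L₁ L₂ cnt).stacks e) .new
        (((Memory.ofLists m L₁ L₂ cnt).stacks e .del).takeWhile (fun _ => true) ++
          (Memory.ofLists m L₁ L₂ cnt).stacks e .new) = x.stacks e := by
      funext k
      cases k <;> simp [Memory.stacks, Memory.ofLists, x, encodeFacts]
    rw [e₁] at r₁
    have r₂ := runs_clear Reg.del ((x.withNew L₃).stacks e)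
    have r₃ := runs_copyWhile (tmp := Reg.tmp) (i := .new) (j := .del) (by simp) (by simp) (by simp)
      (fun _ => true) (S := update ((x.withNew L₃).stacks e) .del []) (by simp [Memory.stacks])
    have r₄ := runs_clear Reg.new (update (update ((x.withNew L₃).stacks e) .del []) .del
      ((update ((x.withNew L₃).stacks e) .del [] .new).takeWhile (fun _ => true) ++
        update ((x.withNew L₃).stacks e) .del [] .del))
    refine (r₁.seq (hr.seq (r₂.seq (r₃.seq r₄)))).congr ?_ ?_
    · funext k
      cases k <;> simp [Memory.stacks, Memory.ofLists, Memory.withNew, x, encodeFacts,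
        takeWhile_const_true]
    · simp [Memory.stacks, Memory.ofLists, Memory.withNew, Memory.size, x] at hl₂ hl₃ ⊢
      omega

end Rules

/-! ### Reaching the fixpoint, and the complete machine -/

section Evaluation

variable {S : Schema} {V A : Type}

/-- The states of the evaluation under stage semantics, or under end semantics. -/
def evalState (stage : Bool) (P : DeltaProgram S V) (D : Database S V) (t : ℕ) : State S V :=
  if stage then stageState P D t else endState P D t

theorem evalState_base (stage : Bool) (P : DeltaProgram S V) (D : Database S V) (t : ℕ) :
    (evalState stage P D t).base =
      {c | c ∈ D ∧ (stage = true → c ∉ (evalState stage P D t).delta)} := by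
  cases stage with
  | true =>
    ext c
    simp [evalState, stageState_base]
  | false =>
    ext c
    simp [evalState, endState_base]

theorem evalState_zero_delta (stage : Bool) (P : DeltaProgram S V) (D : Database S V) :
    (evalState stage P D 0).delta = ∅ := by
  cases stage <;> rfl

theorem evalState_succ_delta (stage : Bool) (P : DeltaProgram S V) (D : Database S V) (t : ℕ) :
    (evalState stage P D (t + 1)).delta =
      (evalState stage P D t).delta ∪ derived P (evalState stage P D t) := by
  cases stage <;> rfl

theorem evalState_eq_of_delta_eq {stage : Bool} {P : DeltaProgram S V} {D : Database S V} {t t' : ℕ}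
    (h : (evalState stage P D t).delta = (evalState stage P D t').delta) :
    evalState stage P D t = evalState stage P D t' :=
  State.ext (by rw [evalState_base, evalState_base, h]) h

theorem evalState_delta_subset (stage : Bool) (P : DeltaProgram S V) (D : Database S V) (t : ℕ) :
    (evalState stage P D t).delta ⊆ ↑D := by
  induction t with
  | zero => simp [evalState_zero_delta]
  | succ t ih =>
    rw [evalState_succ_delta]
    refine Set.union_subset ih ((derived_subset_base P _).trans ?_)
    rw [evalState_base]
    exact fun c hc => hc.1

/-- States with equal delta tuples are equal, so before `T` each round adds a tuple. Hence `T ≤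
|Δ^T| ≤ |D| ≤ n`, and from `T` on nothing changes. -/
theorem evalState_eq_fixpoint {stage : Bool} {P : DeltaProgram S V} {D : Database S V} {T n : ℕ}
    (hT : evalState stage P D T = evalState stage P D (T + 1))
    (hmin : ∀ t < T, evalState stage P D t ≠ evalState stage P D (t + 1)) (hn : D.card ≤ n) :
    evalState stage P D n = evalState stage P D T := by
  have hfin : ∀ t, (evalState stage P D t).delta.Finite := fun t =>
    D.finite_toSet.subset (evalState_delta_subset stage P D t)
  have hcard : ∀ t ≤ T, t ≤ (evalState stage P D t).delta.ncard := by
    intro t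
    induction t with
    | zero => simp
    | succ t ih =>
      intro ht
      refine (ih (by omega)).trans_lt (Set.ncard_lt_ncard ?_ (hfin _))
      refine Set.ssubset_iff_subset_ne.2 ⟨?_, fun h => hmin t ht (evalState_eq_of_delta_eq h)⟩
      rw [evalState_succ_delta]
      exact Set.subset_union_left
  have hle : T ≤ n := by
    refine (hcard T le_rfl).trans (le_trans ?_ hn)
    rw [← Set.ncard_coe_finset]
    exact Set.ncard_le_ncard (evalState_delta_subset stage P D T) D.finite_toSet
  clear hn
  induction n, hle using Nat.le_induction with
  | base => rfl
  | succ n _ ih =>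
    rw [hT]
    exact evalState_eq_of_delta_eq (by rw [evalState_succ_delta, evalState_succ_delta, ih])

theorem endResult_eq {P : DeltaProgram S V} {D : Database S V} {n : ℕ} (hn : D.card ≤ n) :
    endResult P D = (evalState false P D n).delta := by
  classical
  rw [evalState_eq_fixpoint (stage := false) (Nat.find_spec (exists_end_fixpoint P D))
    (fun t ht => Nat.find_min (exists_end_fixpoint P D) ht) hn]
  unfold endResult
  rw [Set.sdiff_sdiff_cancel_left]
  · rfl
  · exact evalState_delta_subset false P D _

theorem stageResult_eq {P : DeltaProgram S V} {D : Database S V} {n : ℕ} (hn : D.card ≤ n) :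
    stageResult P D = (evalState true P D n).delta := by
  classical
  rw [evalState_eq_fixpoint (stage := true) (Nat.find_spec (exists_stage_fixpoint P D))
    (fun t ht => Nat.find_min (exists_stage_fixpoint P D) ht) hn]
  unfold stageResult
  rw [stageState_base, Set.sdiff_sdiff_cancel_left]
  · rfl
  · exact evalState_delta_subset true P D _

variable {m : ℕ}

/-- The program that evaluates the rules. -/
noncomputable def evaluate (e : Computability.Encoding V A) (stage : Bool) (m : ℕ)
    (rs : List (DeltaRule S V)) : Cmd (Reg (m + 1)) (Letter S A) :=
  (Cmd.copyWhile .tmp (fun _ => true) .inp .cnt).seq <|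
    (Cmd.whileTop .cnt (fun _ => true) ((round e stage m rs).seq (Cmd.pop .cnt))).seq
      (Cmd.clear .inp)

theorem listState_eq_evalState {stage : Bool} {P : DeltaProgram S V} {L : Listing S V}
    {L₂ : List (Fact S V)} {k : ℕ}
    (h : {t | t ∈ L₂} = (evalState stage P L.toDatabase k).delta) :
    listState stage L.1 L₂ = evalState stage P L.toDatabase k := by
  refine State.ext ?_ h
  rw [evalState_base, ← h]
  rfl

theorem runs_evaluate [Nonempty V] (e : Computability.Encoding V A) (stage : Bool)
    {P : DeltaProgram S V} (hm : ∀ r ∈ P, ∀ q ∈ r.body, ∀ j, (q.atom.args j).Below (m + 1)) :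
    ∃ p : Polynomial ℕ, ∀ L : Listing S V, ∃ L' : Listing S V,
      (↑L'.toDatabase : Set (Fact S V)) =
        (evalState stage P L.toDatabase (encodeListing e L).length).delta ∧
      Runs (evaluate e stage m P.toList) (update (fun _ => []) .inp (encodeListing e L))
        (update (fun _ => []) .del (encodeListing e L')) (p.eval (encodeListing e L).length) := by
  obtain ⟨p, hp⟩ := runs_round (m := m) e stage hm
  -- After `k` rounds, one further round is run for each letter left on the counter.
  have key : ∀ (L : Listing S V) (cnt : List (Letter S A)) (L₂ : List (Fact S V)) (k : ℕ), L₂.Nodup →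
      L₂ ⊆ L.1 → {t | t ∈ L₂} = (evalState stage P L.toDatabase k).delta →
      ∃ L' : Listing S V, (↑L'.toDatabase : Set (Fact S V)) =
          (evalState stage P L.toDatabase (k + cnt.length)).delta ∧
        Runs (Cmd.whileTop .cnt (fun _ => true) ((round e stage m P.toList).seq (Cmd.pop .cnt)))
          ((Memory.ofLists m L.1 L₂ cnt).stacks e) ((Memory.ofLists m L.1 L'.1 []).stacks e)
          (cnt.length * (p.eval (encodeListing e L).length + 2) + 1) := by
    intro L cnt
    induction cnt with
    | nil =>
      intro L₂ k h₁ h₂ h₃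
      exact ⟨⟨L₂, h₁⟩, h₃, (runs_whileTop_of_not _ rfl).mono (by simp)⟩
    | cons a cnt ih =>
      intro L₂ k h₁ h₂ h₃
      obtain ⟨L₃, h₄, h₅, h₆, h₇⟩ := hp L.1 L₂ (a :: cnt) L.2 h₁ h₂
      obtain ⟨L', h₈, h₉⟩ := ih L₃ (k + 1) h₄ h₅ (by
        rw [evalState_succ_delta, ← h₃, ← listState_eq_evalState h₃]
        ext t
        exact h₆ t)
      refine ⟨L', by rw [h₈, List.length_cons, add_assoc, add_comm 1], ?_⟩
      have h := runs_pop Reg.cnt ((Memory.ofLists m L.1 L₃ (a :: cnt)).stacks e)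
      have heq : update ((Memory.ofLists m L.1 L₃ (a :: cnt)).stacks e) .cnt
          ((Memory.ofLists m L.1 L₃ (a :: cnt)).stacks e .cnt).tail =
            (Memory.ofLists m L.1 L₃ cnt).stacks e := by
        funext k
        cases k <;> simp [Memory.stacks, Memory.ofLists]
      rw [heq] at h
      refine (Runs.whileTop rfl (h₇.seq h) h₉).mono ?_
      rw [List.length_cons, add_mul, show encodeListing e L = encodeFacts e L.1 from rfl]
      omega
  refine ⟨4 * Polynomial.X + 2 + ((Polynomial.X * (p + 2) + 1) + (2 * Polynomial.X + 1)),
    fun L => ?_⟩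
  obtain ⟨L', h₁, h₂⟩ := key L (encodeListing e L) [] 0 List.nodup_nil (List.nil_subset _)
    (by simp [evalState_zero_delta])
  refine ⟨L', by rw [h₁, zero_add], ?_⟩
  have r₁ := runs_copyWhile (tmp := Reg.tmp) (i := .inp) (j := .cnt) (by simp) (by simp) (by simp)
    (fun _ => true) (S := update (fun _ : Reg (m + 1) => []) .inp (encodeListing e L)) (by simp)
  -- In the halting configuration all stacks except the output must be empty.
  have r₃ := runs_clear Reg.inp ((Memory.ofLists m L.1 L'.1 []).stacks e)
  have heq : update (update (fun _ : Reg (m + 1) => []) .inp (encodeListing e L)) .cnt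
      ((update (fun _ : Reg (m + 1) => []) .inp (encodeListing e L) .inp).takeWhile (fun _ => true) ++
        update (fun _ : Reg (m + 1) => []) .inp (encodeListing e L) .cnt) =
      (Memory.ofLists m L.1 [] (encodeListing e L)).stacks e := by
    funext k
    cases k <;> simp [Memory.stacks, Memory.ofLists, encodeFacts, encodeListing]
  rw [heq] at r₁
  refine (r₁.seq (h₂.seq r₃)).congr ?_ ?_
  · funext k
    cases k <;> simp [Memory.stacks, Memory.ofLists, encodeFacts, encodeListing]
  · simp [Memory.stacks, Memory.ofLists, encodeFacts, encodeListing]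

theorem exists_below (P : DeltaProgram S V) :
    ∃ m, ∀ r ∈ P, ∀ q ∈ r.body, ∀ j, (q.atom.args j).Below (m + 1) := by
  have h : ∀ᶠ m in Filter.atTop, ∀ r ∈ P, ∀ q ∈ r.body, ∀ j, (q.atom.args j).Below (m + 1) := by
    refine (Filter.eventually_all_finset P).2 fun r _ =>
      (Filter.eventually_all_finite (List.finite_toSet r.body)).2 fun q _ =>
        Filter.eventually_all.2 fun j => ?_
    cases q.atom.args j with
    | var x => exact (Filter.eventually_ge_atTop x).mono fun m hm => Nat.lt_succ_of_le hm
    | const c => exact Filter.Eventually.of_forall fun _ => trivial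
  exact h.exists

noncomputable instance [Fintype A] : Fintype (Letter S A) :=
  Fintype.ofInjective (β := Fin S.numRel ⊕ Option A)
    (fun | .rel i => .inl i | .char a => .inr (some a) | .sep => .inr none) (by
      rintro (i | a | _) (j | b | _) <;> simp)

theorem polyTimeComputable_of_evalState [Nonempty V] [Fintype A] (e : Computability.Encoding V A)
    (stage : Bool) (P : DeltaProgram S V) {F : Database S V → Set (Fact S V)}
    (hF : ∀ D n, D.card ≤ n → F D = (evalState stage P D n).delta) : PolyTimeComputable e F := by
  obtain ⟨m, hm⟩ := exists_below P
  obtain ⟨p, hp⟩ := runs_evaluate e stage hm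
  choose f hf hr using hp
  refine ⟨f, fun L => (hf L).trans (hF _ _ ?_).symm, ⟨?_⟩⟩
  · exact length_le_length_encodeFacts e L.1
  · refine { tm := (evaluate e stage m P.toList).toFinTM2 .inp .del
             inputAlphabet := Equiv.refl (Letter S A)
             outputAlphabet := Equiv.refl (Letter S A)
             time := p + 1
             outputsFun := fun L => ?_ }
    have h := (hr L).outputs.some
    have hid : ∀ l : List (Letter S A), l.map (Equiv.refl (Letter S A)).invFun = l := List.map_id
    rw [Polynomial.eval_add, Polynomial.eval_one]
    -- The machine works on `Letter S A` itself, so translating the alphabets is the identity.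
    exact (hid (encodeListing e L)).symm ▸ (hid (encodeListing e (f L))).symm ▸ h

end Evaluation

end DeltaRules

theorem mainTheorem3 {V A : Type} [Nonempty V] [Fintype A] (e : Computability.Encoding V A)
    (S : DeltaRules.Schema) (P : DeltaRules.DeltaProgram S V) :
    DeltaRules.PolyTimeComputable e (DeltaRules.endResult P) ∧
      DeltaRules.PolyTimeComputable e (DeltaRules.stageResult P) :=
  ⟨DeltaRules.polyTimeComputable_of_evalState e false P fun _ _ => DeltaRules.endResult_eq,
    DeltaRules.polyTimeComputable_of_evalState e true P fun _ _ => DeltaRules.stageResult_eq⟩
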